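/- **Proposition (Weitzenböck formula).** Let $(M,g)$ be a Kähler surface (complex dimension $2$) with Kähler form $\omega(v,w)=g(Jv,w)$, let $P\to M$ be a smooth principal bundle with compact semi-simple structure group $G$, and let $A$ be a connection on $P$ with curvature $F_A$. Write $g_{ab}=g(\partial_a,\partial_b)$ for the components of the complex bilinear extension of $g$ in the frame $\partial_\mu=\partial/\partial z^\mu$, $\partial_{\bar\mu}=\partial/\partial\bar z^\mu$ of holomorphic coordinates, $(g^{ab})$ for the inverse matrix, and $R_{ab}$ for the Ricci tensor. Put $$\hat F_A=\Lambda_\omega F_A=\sqrt{-1}\sum g^{\tau\bar\sigma}F_{A,\bar\sigma\tau},\qquad S=\tfrac12\sum g^{\bar\sigma\tau}R_{\tau\bar\sigma},$$ so that $S$ is one quarter of the trace of the Ricci tensor (the Riemannian scalar curvature). Let $\mathfrak g_P^{\mathbb C}$ be the complexified adjoint bundle with the hermitian metric induced by minus the Killing form; let $\bar\partial_A$ be the $(0,q+1)$-part of $d_A$ on $\Omega^{0,q}(\mathfrak g_P^{\mathbb C})$, let $\nabla_A$ be the Levi-Civita connection coupled with $A$, let $\nabla_A''$ be its $(0,1)$-part,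 i.e. differentiation in the directions $\partial_{\bar\mu}$ only, and let ${}^*$ denote $L^2$ formal adjoints; put $\Delta_{\bar\partial_A}=\bar\partial_A\bar\partial_A^*+\bar\partial_A^*\bar\partial_A$. Then for every smooth $\phi\in\Omega^{0,2}(\mathfrak g_P^{\mathbb C})$ the formal adjoints below exist and $$\Delta_{\bar\partial_A}\phi=(\nabla_A'')^*\nabla_A''\phi+\sqrt{-1}\,[\hat F_A,\phi]+2S\phi .$$ (Here $(\nabla_A'')^*\nabla_A''=-\sum g^{\sigma\bar\tau}\nabla_{A,\sigma}\nabla_{A,\bar\tau}$ is the operator written $\nabla_A^*\nabla_A$ in the usual short form of the formula.) Equivalently, in terms of the rough Laplacian of the full connection, $$2\,\Delta_{\bar\partial_A}\phi=\nabla_A^*\nabla_A\phi+\sqrt{-1}\,[\hat F_A,\phi]+2S\phi .$$ -/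

import Mathlib

open scoped Manifold ContDiff Topology
open MeasureTheory

noncomputable section

namespace KahlerYM

/-! ### Coordinates on `ℂ²` and the complexified frame -/

/-- The model space `ℂ²` of a complex surface. -/
abbrev C2 : Type := Fin 2 → ℂ

/-- Indices of the complexified coordinate frame: `inl μ` stands for `∂_μ = ∂/∂z^μ` and
`inr μ` for `∂_μ̄ = ∂/∂z̄^μ`. -/
abbrev Idx : Type := Fin 2 ⊕ Fin 2

/-- Complex conjugation of indices, `μ ↔ μ̄`. -/
abbrev bar (a : Idx) : Idx := a.swap

/-- The standard complex basis of `ℂ²`. -/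
def stdVec (μ : Fin 2) : C2 := Pi.single μ 1

/-- Component of a real linear map `L` along `∂_a`, after complex linear extension, where
`∂_μ = (e_μ - √-1 J e_μ) / 2` and `∂_μ̄ = (e_μ + √-1 J e_μ) / 2`. -/
def cpt {W : Type*} [AddCommGroup W] [Module ℂ W] (L : C2 → W) : Idx → W
  | Sum.inl μ => (1 / 2 : ℂ) • (L (stdVec μ) - Complex.I • L (Complex.I • stdVec μ))
  | Sum.inr μ => (1 / 2 : ℂ) • (L (stdVec μ) + Complex.I • L (Complex.I • stdVec μ))

/-- Components `L(∂_a, ∂_b)` of a real bilinear map. -/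
def cpt₂ {W : Type*} [AddCommGroup W] [Module ℂ W] (L : C2 → C2 → W) (a b : Idx) : W :=
  cpt (fun v => cpt (fun w => L v w) b) a

/-- The partial (Wirtinger) derivative `∂_a f`. -/
def pd {W : Type*} [NormedAddCommGroup W] [NormedSpace ℝ W] [Module ℂ W]
    (a : Idx) (f : C2 → W) (z : C2) : W :=
  cpt (fun v => fderiv ℝ f z v) a

/-! ### Complexification of a real normed space -/

/-- The complexification `V ⊗ ℂ = V ⊕ √-1 V`; the pair `(x, y)` stands for `x + √-1 y`. -/
def Cx (V : Type*) : Type _ := V × V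

section Complexification

variable {V : Type*} [NormedAddCommGroup V] [NormedSpace ℝ V]

instance : NormedAddCommGroup (Cx V) := inferInstanceAs (NormedAddCommGroup (V × V))

instance : NormedSpace ℝ (Cx V) := inferInstanceAs (NormedSpace ℝ (V × V))

instance : SMul ℂ (Cx V) :=
  ⟨fun c x => (c.re • x.1 - c.im • x.2, c.re • x.2 + c.im • x.1)⟩

theorem Cx.smul_fst (c : ℂ) (x : Cx V) : (c • x).1 = c.re • x.1 - c.im • x.2 := rfl

theorem Cx.smul_snd (c : ℂ) (x : Cx V) : (c • x).2 = c.re • x.2 + c.im • x.1 := rfl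

theorem Cx.add_fst (x y : Cx V) : (x + y).1 = x.1 + y.1 := rfl

theorem Cx.add_snd (x y : Cx V) : (x + y).2 = x.2 + y.2 := rfl

theorem Cx.zero_fst : (0 : Cx V).1 = 0 := rfl

theorem Cx.zero_snd : (0 : Cx V).2 = 0 := rfl

instance : Module ℂ (Cx V) where
  one_smul x := by
    refine Prod.ext ?_ ?_ <;> simp [Cx.smul_fst, Cx.smul_snd]
  mul_smul c d x := by
    refine Prod.ext ?_ ?_ <;>
      simp only [Cx.smul_fst, Cx.smul_snd, Complex.mul_re, Complex.mul_im] <;> module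
  smul_zero c := by
    refine Prod.ext ?_ ?_ <;>
      simp only [Cx.smul_fst, Cx.smul_snd, Cx.zero_fst, Cx.zero_snd] <;> simp
  smul_add c x y := by
    refine Prod.ext ?_ ?_ <;>
      simp only [Cx.smul_fst, Cx.smul_snd, Cx.add_fst, Cx.add_snd] <;> module
  add_smul c d x := by
    refine Prod.ext ?_ ?_ <;>
      simp only [Cx.smul_fst, Cx.smul_snd, Cx.add_fst, Cx.add_snd, Complex.add_re,
        Complex.add_im] <;> module
  zero_smul x := by
    refine Prod.ext ?_ ?_ <;>
      simp only [Cx.smul_fst, Cx.smul_snd, Cx.zero_fst, Cx.zero_snd] <;> simp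

/-- The inclusion `V → V ⊗ ℂ`. -/
def Cx.ofReal (x : V) : Cx V := (x, 0)

end Complexification

/-! ### Local differential geometry

`Patch V` records the local expression of all the geometric data, over a holomorphic coordinate
domain `D ⊆ ℂ²` on which the principal bundle is trivialised. All operators below are differential
operators, hence local, and are written out on such a patch; the test forms in the definition of
the formal adjoints are the ones supported in the patch. -/

/-- Local data: the domain, the metric, the connection form (with values in the Lie algebra `V`),
and the bracket and the invariant inner product of the Lie algebra. -/
structure Patch (V : Type*) where
  /-- the domain in `ℂ²` -/
  D : Set C2
  /-- the Riemannian metric -/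
  g : C2 → C2 → C2 → ℝ
  /-- the connection form -/
  A : C2 → C2 → V
  /-- the Lie bracket -/
  br : V → V → V
  /-- the inner product of the Lie algebra -/
  ip : V → V → ℝ

namespace Patch

section Metric

variable {V : Type*} (P : Patch V)

/-- The metric components `g_ab = g(∂_a, ∂_b)` (complex bilinear extension). -/
def gLow (z : C2) (a b : Idx) : ℂ := cpt₂ (fun v w => (P.g z v w : ℂ)) a b

/-- The inverse `g^ab` of the matrix `g_ab`. -/
def gUp (z : C2) (a b : Idx) : ℂ := ((Matrix.of (P.gLow z))⁻¹ : Matrix Idx Idx ℂ) a b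

/-- The Kähler form, `ω(v, w) = g(J v, w)`. -/
def kahlerForm (z v w : C2) : ℝ := P.g z (Complex.I • v) w

/-- The components `ω_ab` of the Kähler form. -/
def omega (z : C2) (a b : Idx) : ℂ := cpt₂ (fun v w => (P.kahlerForm z v w : ℂ)) a b

/-- The density of the Riemannian measure with respect to Lebesgue measure on `ℂ²`. (The
transition matrix between the real coordinate frame and `(∂_a)` has determinant `1/4` in modulus,
hence the factor `4`.) -/
def vol (z : C2) : ℝ := 4 * Real.sqrt ‖(Matrix.of (P.gLow z)).det‖

/-- Christoffel symbols `Γ^c_ab` of the Levi-Civita connection: `∇_{∂_a} ∂_b = Γ^c_ab ∂_c`. -/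
def Gam (z : C2) (c a b : Idx) : ℂ :=
  (1 / 2 : ℂ) * ∑ d, P.gUp z c d *
    (pd a (fun w => P.gLow w b d) z + pd b (fun w => P.gLow w a d) z
      - pd d (fun w => P.gLow w a b) z)

/-- Curvature tensor: `R(∂_a, ∂_b) ∂_c = riem d c a b ∂_d`. -/
def riem (z : C2) (d c a b : Idx) : ℂ :=
  pd a (fun w => P.Gam w d b c) z - pd b (fun w => P.Gam w d a c) z
    + ∑ e, (P.Gam z d a e * P.Gam z e b c - P.Gam z d b e * P.Gam z e a c)

/-- The Ricci tensor, `Ric(Y, Z) = tr (X ↦ R(X, Y) Z)`. -/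
def ricci (z : C2) (b c : Idx) : ℂ := ∑ a, P.riem z a c a b

/-- The scalar curvature in the Kähler normalisation, `S = (1/2) ∑ g^{σ̄τ} R_{τσ̄}`, which is a
quarter of the trace of the Ricci tensor of a Kähler metric. -/
def S (z : C2) : ℂ :=
  (1 / 2 : ℂ) * ∑ σ : Fin 2, ∑ τ : Fin 2,
    P.gUp z (Sum.inr σ) (Sum.inl τ) * P.ricci z (Sum.inl τ) (Sum.inr σ)

end Metric

variable {V : Type*} [NormedAddCommGroup V] [NormedSpace ℝ V] (P : Patch V)

/-- The complex bilinear extension of the bracket to `V ⊗ ℂ`. -/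
def brC (x y : Cx V) : Cx V :=
  ((P.br x.1 y.1 - P.br x.2 y.2, P.br x.1 y.2 + P.br x.2 y.1) : V × V)

/-- The hermitian extension of the inner product to `V ⊗ ℂ` (conjugate linear in the second
variable). -/
def ipC (x y : Cx V) : ℂ :=
  ((P.ip x.1 y.1 + P.ip x.2 y.2 : ℝ) : ℂ) + Complex.I * ((P.ip x.2 y.1 - P.ip x.1 y.2 : ℝ) : ℂ)

/-- The components `A_a` of the connection form. -/
def conn (z : C2) (a : Idx) : Cx V := cpt (fun v => Cx.ofReal (P.A z v)) a

/-- The curvature `F_ab = ∂_a A_b - ∂_b A_a + [A_a, A_b]`. -/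
def curv (z : C2) (a b : Idx) : Cx V :=
  pd a (fun w => P.conn w b) z - pd b (fun w => P.conn w a) z + P.brC (P.conn z a) (P.conn z b)

/-- `F̂ = Λ_ω F`, the contraction `(1/2) ω^{ab} F_ab` of the curvature with the Kähler form. -/
def fHat (z : C2) : Cx V :=
  (1 / 2 : ℂ) • ∑ a, ∑ b, ∑ c, ∑ d,
    (P.gUp z a c * P.gUp z b d * P.omega z c d) • P.curv z a b

/-- Covariant tensor fields of rank `k` with values in the complexified adjoint bundle, by their
components along `∂_{a_1}, …, ∂_{a_k}`. -/
abbrev Tens (V : Type*) (k : ℕ) : Type _ := C2 → (Fin k → Idx) → Cx V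

variable {k l : ℕ}

/-- The covariant derivative `∇_A` (Levi-Civita connection coupled with `A`):
`(∇_A T)_{a b_1 … b_k} = ∂_a T_b + [A_a, T_b] - ∑_j Γ^c_{a b_j} T_{b_1 … c … b_k}`. -/
def nabla (T : Tens V k) : Tens V (k + 1) := fun z a =>
  pd (a 0) (fun w => T w (Fin.tail a)) z + P.brC (P.conn z (a 0)) (T z (Fin.tail a))
    - ∑ j : Fin k, ∑ c : Idx,
        P.Gam z c (a 0) (Fin.tail a j) • T z (Function.update (Fin.tail a) j c)

/-- The `(0,1)`-part of `∇_A`: differentiation in the directions `∂_μ̄` only. -/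
def nablaBar (T : Tens V k) : Tens V (k + 1) := fun z a =>
  if (a 0).isRight then P.nabla T z a else 0

/-- The covariant exterior derivative `d_A` on `k`-forms. -/
def extCov (T : Tens V k) : Tens V (k + 1) := fun z a =>
  ∑ j : Fin (k + 1), (-1 : ℂ) ^ (j : ℕ) •
    (pd (a j) (fun w => T w (j.removeNth a)) z
      + P.brC (P.conn z (a j)) (T z (j.removeNth a)))

/-- `∂̄_A` on `(0,k)`-forms: the `(0,k+1)`-component of `d_A`. -/
def dbar (T : Tens V k) : Tens V (k + 1) := fun z a =>
  if ∀ j, (a j).isRight then P.extCov T z a else 0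

/-- `T` is a smooth `(0,k)`-form on `D`. -/
structure IsForm (D : Set C2) (T : Tens V k) : Prop where
  smooth : ∀ a, ContDiffOn ℝ ∞ (fun z => T z a) D
  alternating : ∀ z ∈ D, ∀ (σ : Equiv.Perm (Fin k)) a, T z (a ∘ σ) = Equiv.Perm.sign σ • T z a
  type : ∀ z ∈ D, ∀ a, ¬ (∀ j, (a j).isRight) → T z a = 0

/-- `T` is a smooth `(0,k)`-form with compact support contained in the domain of the patch. -/
structure IsTestForm (T : Tens V k) : Prop where
  isForm : IsForm Set.univ T
  compact : HasCompactSupport T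
  support : tsupport T ⊆ P.D

/-- The pointwise hermitian inner product of tensors,
`⟨S, T⟩ = ∑ g^{a_1 b_1} ⋯ g^{a_k b_k} ⟨S_a, T_{b̄}⟩`. -/
def tensIP (z : C2) (S T : (Fin k → Idx) → Cx V) : ℂ :=
  ∑ a : Fin k → Idx, ∑ b : Fin k → Idx,
    (∏ j, P.gUp z (a j) (b j)) * P.ipC (S a) (T (fun j => bar (b j)))

/-- The pointwise hermitian inner product of `k`-forms. -/
def formIP (z : C2) (S T : (Fin k → Idx) → Cx V) : ℂ :=
  ((k.factorial : ℂ))⁻¹ * P.tensIP z S T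

/-- The `(0,k)`-form `χ` is `∂̄_A^* ψ`, for the `L²` formal adjoint of `∂̄_A`:
`∫ ⟨∂̄_A β, ψ⟩ dvol = ∫ ⟨β, χ⟩ dvol` for all compactly supported `(0,k)`-forms `β`. -/
structure IsDbarStar (ψ : Tens V (k + 1)) (χ : Tens V k) : Prop where
  isForm : IsForm P.D χ
  adjoint : ∀ β : Tens V k, P.IsTestForm β →
    ∫ z in P.D, P.formIP z (P.dbar β z) (ψ z) * (P.vol z : ℂ)
      = ∫ z in P.D, P.formIP z (β z) (χ z) * (P.vol z : ℂ)

/-- The `(0,k)`-form `χ` is `∇_A^* ψ`, for the `L²` formal adjoint of `∇_A` on `(0,k)`-forms. -/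
structure IsNablaStar (ψ : Tens V (k + 1)) (χ : Tens V k) : Prop where
  isForm : IsForm P.D χ
  adjoint : ∀ β : Tens V k, P.IsTestForm β →
    ∫ z in P.D, P.tensIP z (P.nabla β z) (ψ z) * (P.vol z : ℂ)
      = ∫ z in P.D, P.tensIP z (β z) (χ z) * (P.vol z : ℂ)

/-- The same for the `(0,1)`-part of `∇_A`. -/
structure IsNablaBarStar (ψ : Tens V (k + 1)) (χ : Tens V k) : Prop where
  isForm : IsForm P.D χ
  adjoint : ∀ β : Tens V k, P.IsTestForm β →
    ∫ z in P.D, P.tensIP z (P.nablaBar β z) (ψ z) * (P.vol z : ℂ)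
      = ∫ z in P.D, P.tensIP z (β z) (χ z) * (P.vol z : ℂ)

open Classical in
/-- The formal adjoint `∂̄_A^*` (zero by convention where it does not exist). -/
def dbarStar (ψ : Tens V (k + 1)) : Tens V k :=
  if h : ∃ χ, P.IsDbarStar ψ χ then h.choose else 0

open Classical in
/-- The formal adjoint `∇_A^*` (zero by convention where it does not exist). -/
def nablaStar (ψ : Tens V (k + 1)) : Tens V k :=
  if h : ∃ χ, P.IsNablaStar ψ χ then h.choose else 0

open Classical in
/-- The formal adjoint of the `(0,1)`-part of `∇_A` (zero by convention where it does not
exist). -/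
def nablaBarStar (ψ : Tens V (k + 1)) : Tens V k :=
  if h : ∃ χ, P.IsNablaBarStar ψ χ then h.choose else 0

/-- `Δ_{∂̄_A} = ∂̄_A ∂̄_A^* + ∂̄_A^* ∂̄_A`, in positive degrees. -/
def laplacianDbar (T : Tens V (k + 1)) : Tens V (k + 1) :=
  P.dbar (P.dbarStar T) + P.dbarStar (P.dbar T)

end Patch

/-! ### Kähler surfaces -/

section Surface

variable {M : Type*} [TopologicalSpace M] [ChartedSpace C2 M]

/-- The smooth real manifold underlying a complex surface. -/
instance [h : IsManifold 𝓘(ℂ, C2) ω M] : IsManifold 𝓘(ℝ, C2) ∞ M := by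
  refine isManifold_of_contDiffOn _ _ _ fun e e' he he' => ?_
  have h1 := h.compatible he he'
  rw [contDiffGroupoid, mem_groupoid_of_pregroupoid] at h1
  have h2 := (h1.1 : ContDiffOn ℂ ω _ _)
  simpa using (h2.restrict_scalars ℝ).of_le le_top

/-- The differential at `z` of the inverse of the chart `e`. -/
def dSymm (e : OpenPartialHomeomorph M C2) (z v : C2) : TangentSpace 𝓘(ℝ, C2) (e.symm z) :=
  mfderiv 𝓘(ℝ, C2) 𝓘(ℝ, C2) e.symm z v

variable [IsManifold 𝓘(ℝ, C2) ∞ M]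

/-- A smooth Riemannian metric on the real manifold underlying `M`. -/
abbrev Metric (M : Type*) [TopologicalSpace M] [ChartedSpace C2 M] [IsManifold 𝓘(ℝ, C2) ∞ M] :
    Type _ :=
  Bundle.ContMDiffRiemannianMetric 𝓘(ℝ, C2) ∞ C2 (fun x : M => TangentSpace 𝓘(ℝ, C2) x)

/-- The metric in the chart `e`. -/
def Metric.loc (g : Metric M) (e : OpenPartialHomeomorph M C2) (z v w : C2) : ℝ :=
  g.inner (e.symm z) (dSymm e z v) (dSymm e z w)

/-- The metric is Kähler: it is invariant under the complex structure, and the form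
`ω(v, w) = g(J v, w)` is closed. -/
structure Metric.IsKahler (g : Metric M) : Prop where
  invariant : ∀ e ∈ atlas C2 M, ∀ z ∈ e.target, ∀ v w : C2,
    g.loc e z (Complex.I • v) (Complex.I • w) = g.loc e z v w
  closed : ∀ e ∈ atlas C2 M, ∀ z ∈ e.target, ∀ u v w : C2,
    fderiv ℝ (fun y => g.loc e y (Complex.I • v) w) z u
      + fderiv ℝ (fun y => g.loc e y (Complex.I • w) u) z v
      + fderiv ℝ (fun y => g.loc e y (Complex.I • u) v) z w = 0

end Surface

/-! ### Principal bundles, connections and forms with values in the adjoint bundle -/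

/-- The model space of a Lie group of dimension `m`. -/
abbrev Vm (m : ℕ) : Type := EuclideanSpace ℝ (Fin m)

section Bundle

variable {m : ℕ} {G : Type*} [TopologicalSpace G] [ChartedSpace (Vm m) G] [Group G]

/-- The regularity required by the Lie algebra of a Lie group. -/
instance [h : LieGroup 𝓘(ℝ, Vm m) ∞ G] : LieGroup 𝓘(ℝ, Vm m) (minSmoothness ℝ 3) G := by
  refine LieGroup.of_le (n := ∞) ?_
  rw [minSmoothness_of_isRCLikeNormedField]
  exact WithTop.coe_le_coe.2 le_top

/-- The Lie bracket of the Lie algebra of `G`, on the underlying vector space. -/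
def lieBr (G : Type*) [TopologicalSpace G] [ChartedSpace (Vm m) G] [Group G] (x y : Vm m) : Vm m :=
  Bracket.bracket (L := GroupLieAlgebra 𝓘(ℝ, Vm m) G) (M := GroupLieAlgebra 𝓘(ℝ, Vm m) G) x y

/-- The inner product `-κ`, where `κ` is the Killing form of the Lie algebra of `G`. -/
def negKilling (G : Type*) [TopologicalSpace G] [ChartedSpace (Vm m) G] [Group G]
    [LieGroup 𝓘(ℝ, Vm m) ∞ G] (x y : Vm m) : ℝ :=
  - killingForm ℝ (GroupLieAlgebra 𝓘(ℝ, Vm m) G) x y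

/-- The adjoint representation of `G`. -/
def Ad (a : G) : Vm m →L[ℝ] Vm m :=
  mfderiv 𝓘(ℝ, Vm m) 𝓘(ℝ, Vm m) (fun h : G => a * h * a⁻¹) 1

/-- The complexified adjoint representation. -/
def AdC (a : G) (x : Cx (Vm m)) : Cx (Vm m) := ((Ad a x.1, Ad a x.2) : Vm m × Vm m)

variable {M : Type*} [TopologicalSpace M] [ChartedSpace C2 M]

/-- A smooth principal `G`-bundle on `M`, given by local trivialisations over an open cover
`U i` (local sections `s i`) and transition functions, `s j = s i · t i j`. -/
structure PrincipalBundle (m : ℕ) (G M : Type*) [TopologicalSpace G] [ChartedSpace (Vm m) G]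
    [Group G] [TopologicalSpace M] [ChartedSpace C2 M] (ι : Type*) where
  /-- the open cover -/
  U : ι → Set M
  isOpen : ∀ i, IsOpen (U i)
  cover : ∀ x, ∃ i, x ∈ U i
  /-- the transition functions -/
  t : ι → ι → M → G
  smooth : ∀ i j, ContMDiffOn 𝓘(ℝ, C2) 𝓘(ℝ, Vm m) ∞ (t i j) (U i ∩ U j)
  cocycle : ∀ i j l, ∀ x ∈ U i ∩ U j ∩ U l, t i j x * t j l x = t i l x

variable {ι : Type*}

/-- The part of the chart `e` over which the `i`-th trivialisation is defined. -/
def PrincipalBundle.dom (P : PrincipalBundle m G M ι) (e : OpenPartialHomeomorph M C2) (i : ι) :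
    Set C2 :=
  e.target ∩ e.symm ⁻¹' P.U i

/-- The Lie algebra valued `1`-form `t⁻¹ dt` at `x`: the differential at `x` of
`y ↦ t(x)⁻¹ t(y)`. -/
def maurerCartan (t : M → G) (x : M) (v : TangentSpace 𝓘(ℝ, C2) x) : Vm m :=
  mfderiv 𝓘(ℝ, C2) 𝓘(ℝ, Vm m) (fun y => (t x)⁻¹ * t y) x v

/-- A connection on `P`: smooth local connection forms `A i = (s i)^* A` with values in the Lie
algebra, with `A j = Ad(t⁻¹) A i + t⁻¹ dt` for `t = t i j`. -/
structure Connection (P : PrincipalBundle m G M ι) where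
  /-- the local connection forms -/
  form : ι → (x : M) → TangentSpace 𝓘(ℝ, C2) x →L[ℝ] Vm m
  smooth : ∀ e ∈ atlas C2 M, ∀ i, ∀ v : C2,
    ContDiffOn ℝ ∞ (fun z => form i (e.symm z) (dSymm e z v)) (P.dom e i)
  gauge : ∀ i j, ∀ x ∈ P.U i ∩ P.U j, ∀ v : TangentSpace 𝓘(ℝ, C2) x,
    form j x v = Ad (P.t i j x)⁻¹ (form i x v)
      + maurerCartan (P.t i j) x v

/-- An element of `Ω^{0,2}` with values in the complexified adjoint bundle of `P`: smooth local
`2`-forms, complex antilinear in each argument, with `φ i = Ad(t i j) φ j`. -/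
structure Form02 (P : PrincipalBundle m G M ι) where
  /-- the local forms -/
  form : ι → (x : M) → TangentSpace 𝓘(ℝ, C2) x [⋀^Fin 2]→ₗ[ℝ] Cx (Vm m)
  smooth : ∀ e ∈ atlas C2 M, ∀ i, ∀ v w : C2,
    ContDiffOn ℝ ∞ (fun z => form i (e.symm z) ![dSymm e z v, dSymm e z w]) (P.dom e i)
  antilinear : ∀ e ∈ atlas C2 M, ∀ i, ∀ z ∈ P.dom e i, ∀ v w : C2,
    form i (e.symm z) ![dSymm e z (Complex.I • v), dSymm e z w]
      = -(Complex.I • form i (e.symm z) ![dSymm e z v, dSymm e z w])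
  gauge : ∀ i j, ∀ x ∈ P.U i ∩ P.U j, ∀ v : Fin 2 → TangentSpace 𝓘(ℝ, C2) x,
    form i x v = AdC (P.t i j x) (form j x v)

/-- The components `φ_ab` in the chart `e` and the trivialisation `i`. -/
def Form02.loc {P : PrincipalBundle m G M ι} (φ : Form02 P) (e : OpenPartialHomeomorph M C2)
    (i : ι) : Patch.Tens (Vm m) 2 := fun z a =>
  cpt₂ (fun v w => φ.form i (e.symm z) ![dSymm e z v, dSymm e z w]) (a 0) (a 1)

/-- The local expression of a metric and a connection, in the chart `e` and the trivialisation
`i`. -/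
def Connection.patch [LieGroup 𝓘(ℝ, Vm m) ∞ G] [IsManifold 𝓘(ℝ, C2) ∞ M]
    {P : PrincipalBundle m G M ι} (A : Connection P)
    (g : Metric M) (e : OpenPartialHomeomorph M C2) (i : ι) : Patch (Vm m) where
  D := P.dom e i
  g := g.loc e
  A := fun z v => A.form i (e.symm z) (dSymm e z v)
  br := lieBr G
  ip := negKilling G

end Bundle

end KahlerYM

end

open scoped Manifold ContDiff Topology
open MeasureTheory

noncomputable section

namespace KahlerYM

open scoped ComplexConjugate

/-! ### The complexification as a normed space -/

section Complexification

variable {V : Type*} [NormedAddCommGroup V] [NormedSpace ℝ V]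

/-! On a complex surface a `(0,2)`-form has a single independent component `u`, the one along `0̄
1̄` (`IsForm.eq_eps`). Write `D_a` for `covD`, `K_a` for `covK` and `h^{ν̄μ}` for `invHerm`. The
Levi-Civita connection acts on this line bundle by the trace of its Christoffel symbols, so `K_μ =
D_μ` and `K_ν̄ = D_ν̄ - γ_ν` with `γ_ν = ∂_ν̄ log det h` (`IsForm.nabla_eq`).

Integration by parts gives the adjoints explicitly (`isDbarStar`, `isNablaStar`). The Riemannian
density is `4 det h`, which cancels the `1 / det h` in the norm of a `(0,2)`-form. Derivatives that
fall on `h^{ν̄μ}` only produce `γ`, because the Kähler condition makes the cofactor matrix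
divergence free. The outcome is `∂̄_A ∂̄_A^* u = -∑ h^{ν̄μ} K_ν̄ D_μ u` and `(∇_A'')^* ∇_A'' u = -∑
h^{ν̄μ} D_μ K_ν̄ u`, while `∂̄_A φ = 0` since there are no `(0,3)`-forms.

The two operators differ by the contraction of the commutator `[K_ν̄, D_μ] = F_{ν̄μ} + ∂_μ γ_ν`. The
first term contributes `√-1 [F̂, u]`, since `F̂ = √-1 ∑ h^{ν̄μ} F_{ν̄μ}`; the second contributes `2
S u`, since `R_{μν̄} = -∂_μ γ_ν` (`ricci_eq`). This is `laplacian_sub`. The `(1,0)`-part of the full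
rough Laplacian is again `-∑ h^{ν̄μ} K_ν̄ D_μ`, that is `Δ_∂̄` itself (`nablaAdj_covK`); adding it
to both sides gives the second formula.

The adjoint operators are defined by choice, so their values must be pinned down by uniqueness. This
follows from the fundamental lemma of the calculus of variations and the nondegeneracy of the
Killing form (`eq_zero_of_integral`, `negKilling_nondeg`). -/

instance : IsScalarTower ℝ ℂ (Cx V) where
  smul_assoc r c x := by
    refine Prod.ext ?_ ?_
    · change (r • c).re • x.1 - (r • c).im • x.2 = r • (c.re • x.1 - c.im • x.2)
      simp only [Complex.smul_re, Complex.smul_im, smul_eq_mul]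
      module
    · change (r • c).re • x.2 + (r • c).im • x.1 = r • (c.re • x.2 + c.im • x.1)
      simp only [Complex.smul_re, Complex.smul_im, smul_eq_mul]
      module

theorem Cx.real_smul (r : ℝ) (x : Cx V) : r • x = (r : ℂ) • x := by
  rw [← smul_one_smul ℂ r x]
  simp

instance : SMulCommClass ℝ ℂ (Cx V) where
  smul_comm r c x := by
    rw [Cx.real_smul, Cx.real_smul, smul_comm]

instance : ContinuousSMul ℂ (Cx V) where
  continuous_smul := by
    have h1 : Continuous fun p : ℂ × Cx V => p.2.1 :=
      (continuous_fst (X := V) (Y := V)).comp continuous_snd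
    have h2 : Continuous fun p : ℂ × Cx V => p.2.2 :=
      (continuous_snd (X := V) (Y := V)).comp continuous_snd
    have hr : Continuous fun p : ℂ × Cx V => p.1.re := Complex.continuous_re.comp continuous_fst
    have hi : Continuous fun p : ℂ × Cx V => p.1.im := Complex.continuous_im.comp continuous_fst
    exact ((hr.smul h1).sub (hi.smul h2)).prodMk ((hr.smul h2).add (hi.smul h1))

instance [FiniteDimensional ℝ V] : FiniteDimensional ℝ (Cx V) :=
  inferInstanceAs (FiniteDimensional ℝ (V × V))

end Complexification

/-! ### The coordinate frame -/

/-- The real coordinate vector from which `∂_a` is built. -/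
def base : Idx → C2 := Sum.elim stdVec stdVec

/-- The coefficient of the rotated coordinate vector in `2 ∂_a`. -/
def frameSign : Idx → ℂ := Sum.elim (fun _ => -Complex.I) (fun _ => Complex.I)

theorem base_bar (a : Idx) : base (bar a) = base a := by cases a <;> rfl

theorem frameSign_bar (a : Idx) : frameSign (bar a) = conj (frameSign a) := by
  cases a <;> simp [frameSign]

/-- A single formula for barred and unbarred indices, so that later computations need no case split.
-/
theorem cpt_eq {W : Type*} [AddCommGroup W] [Module ℂ W] (L : C2 → W) (a : Idx) :
    cpt L a = (1 / 2 : ℂ) • (L (base a) + frameSign a • L (Complex.I • base a)) := by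
  cases a with
  | inl μ => simp [cpt, base, frameSign, sub_eq_add_neg]
  | inr μ => simp [cpt, base, frameSign]

/-! ### Wirtinger derivatives -/

section RealSmooth

variable {U W Z : Type*} [NormedAddCommGroup U] [NormedSpace ℝ U]
  [NormedAddCommGroup W] [NormedSpace ℝ W] [NormedAddCommGroup Z] [NormedSpace ℝ Z]

theorem contDiffOn_fderiv_apply {D : Set C2} (hD : IsOpen D) {f : C2 → W}
    (hf : ContDiffOn ℝ ∞ f D) (v : C2) : ContDiffOn ℝ ∞ (fun z => fderiv ℝ f z v) D :=
  (hf.fderiv_of_isOpen hD (m := ∞) (by simp)).clm_apply contDiffOn_const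

theorem differentiableAt_of_isOpen {D : Set C2} (hD : IsOpen D) {f : C2 → W}
    (hf : ContDiffOn ℝ ∞ f D) {z : C2} (hz : z ∈ D) : DifferentiableAt ℝ f z :=
  (hf.contDiffAt (hD.mem_nhds hz)).differentiableAt (by simp)

variable [FiniteDimensional ℝ U] [FiniteDimensional ℝ W]

/-- Real bilinearity is all that is asked, so the same rule covers scalar multiplication, the
complex bilinear bracket and the sesquilinear hermitian form. -/
theorem fderiv_bilin (B : U →ₗ[ℝ] W →ₗ[ℝ] Z) {f : C2 → U} {g : C2 → W} {z : C2}
    (hf : DifferentiableAt ℝ f z) (hg : DifferentiableAt ℝ g z) (v : C2) :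
    fderiv ℝ (fun w => B (f w) (g w)) z v = B (fderiv ℝ f z v) (g z) + B (f z) (fderiv ℝ g z v) := by
  have h := (LinearMap.toContinuousBilinearMap B).hasFDerivAt_of_bilinear hf.hasFDerivAt
    hg.hasFDerivAt
  have h2 := h.fderiv
  simp only [LinearMap.toContinuousBilinearMap_apply] at h2
  rw [h2]
  simp [add_comm]

theorem contDiffOn_bilin {n : ℕ∞ω} (B : U →ₗ[ℝ] W →ₗ[ℝ] Z) {f : C2 → U} {g : C2 → W}
    {D : Set C2} (hf : ContDiffOn ℝ n f D) (hg : ContDiffOn ℝ n g D) :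
    ContDiffOn ℝ n (fun w => B (f w) (g w)) D :=
  (LinearMap.toContinuousBilinearMap B).isBoundedBilinearMap.contDiff.comp_contDiffOn
    (hf.prodMk hg)

end RealSmooth

section Wirtinger

variable {U W Z : Type*}
  [NormedAddCommGroup U] [NormedSpace ℝ U] [Module ℂ U]
  [NormedAddCommGroup W] [NormedSpace ℝ W] [Module ℂ W]
  [NormedAddCommGroup Z] [NormedSpace ℝ Z] [Module ℂ Z]

theorem pd_eq (a : Idx) (f : C2 → W) (z : C2) :
    pd a f z = (1 / 2 : ℂ) • (fderiv ℝ f z (base a)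
      + frameSign a • fderiv ℝ f z (Complex.I • base a)) := by
  rw [pd, cpt_eq]

theorem pd_congr {f g : C2 → W} {z : C2} (h : f =ᶠ[𝓝 z] g) (a : Idx) : pd a f z = pd a g z := by
  simp only [pd_eq, h.fderiv_eq]

theorem pd_congr_on {D : Set C2} (hD : IsOpen D) {f g : C2 → W} (h : ∀ z ∈ D, f z = g z) {z : C2}
    (hz : z ∈ D) (a : Idx) : pd a f z = pd a g z :=
  pd_congr (Filter.eventually_of_mem (hD.mem_nhds hz) h) a

@[simp] theorem pd_const (a : Idx) (c : W) (z : C2) : pd a (fun _ => c) z = 0 := by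
  simp [pd_eq]

theorem pd_add (a : Idx) {f g : C2 → W} {z : C2} (hf : DifferentiableAt ℝ f z)
    (hg : DifferentiableAt ℝ g z) : pd a (fun w => f w + g w) z = pd a f z + pd a g z := by
  simp only [pd_eq, fderiv_fun_add hf hg, _root_.add_apply]
  module

theorem pd_sub (a : Idx) {f g : C2 → W} {z : C2} (hf : DifferentiableAt ℝ f z)
    (hg : DifferentiableAt ℝ g z) : pd a (fun w => f w - g w) z = pd a f z - pd a g z := by
  simp only [pd_eq, fderiv_fun_sub hf hg, _root_.sub_apply]
  module

theorem pd_neg (a : Idx) (f : C2 → W) (z : C2) : pd a (fun w => -f w) z = -pd a f z := by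
  simp only [pd_eq, fderiv_fun_neg, _root_.neg_apply]
  module

theorem pd_sum (a : Idx) {κ : Type*} (s : Finset κ) {f : κ → C2 → W} {z : C2}
    (hf : ∀ i ∈ s, DifferentiableAt ℝ (f i) z) :
    pd a (fun w => ∑ i ∈ s, f i w) z = ∑ i ∈ s, pd a (f i) z := by
  simp only [pd_eq, fderiv_fun_sum hf, _root_.sum_apply, Finset.smul_sum,
    Finset.sum_add_distrib, smul_add]

variable [FiniteDimensional ℝ U] [FiniteDimensional ℝ W]

theorem pd_bilin (B : U →ₗ[ℝ] W →ₗ[ℝ] Z) (h1 : ∀ (c : ℂ) x y, B (c • x) y = c • B x y)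
    (h2 : ∀ (c : ℂ) x y, B x (c • y) = c • B x y) (a : Idx) {f : C2 → U} {g : C2 → W} {z : C2}
    (hf : DifferentiableAt ℝ f z) (hg : DifferentiableAt ℝ g z) :
    pd a (fun w => B (f w) (g w)) z = B (pd a f z) (g z) + B (f z) (pd a g z) := by
  simp only [pd_eq, fderiv_bilin B hf hg, h1, h2, map_add, LinearMap.add_apply]
  module

/-- Pulling the coefficient of `∂_a` out of the conjugate linear slot conjugates it, which turns
`∂_a` into `∂_ā` there. -/
theorem pd_sesq (B : U →ₗ[ℝ] W →ₗ[ℝ] Z) (h1 : ∀ (c : ℂ) x y, B (c • x) y = c • B x y)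
    (h2 : ∀ (c : ℂ) x y, B x (c • y) = conj c • B x y) (a : Idx) {f : C2 → U} {g : C2 → W}
    {z : C2} (hf : DifferentiableAt ℝ f z) (hg : DifferentiableAt ℝ g z) :
    pd a (fun w => B (f w) (g w)) z = B (pd a f z) (g z) + B (f z) (pd (bar a) g z) := by
  simp only [pd_eq, fderiv_bilin B hf hg, h1, h2, map_add, LinearMap.add_apply, base_bar,
    frameSign_bar, Complex.conj_conj]
  simp only [map_div₀, map_one, map_ofNat]
  module

end Wirtinger

section Smooth

variable {W : Type*} [NormedAddCommGroup W] [NormedSpace ℝ W] [Module ℂ W]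
  [SMulCommClass ℝ ℂ W] [ContinuousSMul ℂ W]

theorem contDiffOn_cpt {n : ℕ∞ω} {D : Set C2} {L : C2 → C2 → W}
    (hL : ∀ v, ContDiffOn ℝ n (fun z => L z v) D) (a : Idx) :
    ContDiffOn ℝ n (fun z => cpt (L z) a) D := by
  simp only [cpt_eq]
  exact ((hL _).add ((hL _).const_smul _)).const_smul _

theorem fderiv_cpt {L : C2 → C2 → W} {z : C2} (hL : ∀ v, DifferentiableAt ℝ (fun z => L z v) z)
    (a : Idx) (u : C2) :
    fderiv ℝ (fun z => cpt (L z) a) z u = cpt (fun v => fderiv ℝ (fun z => L z v) z u) a := by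
  simp only [cpt_eq]
  rw [fderiv_fun_const_smul (f := fun z => L z (base a) + frameSign a • L z (Complex.I • base a))
      ((hL _).add ((hL _).const_smul _)),
    fderiv_fun_add (g := fun z => frameSign a • L z (Complex.I • base a)) (hL _)
      ((hL _).const_smul _), fderiv_fun_const_smul (hL _)]
  rfl

theorem contDiffOn_pd {D : Set C2} (hD : IsOpen D) {f : C2 → W} (hf : ContDiffOn ℝ ∞ f D)
    (a : Idx) : ContDiffOn ℝ ∞ (pd a f) D :=
  contDiffOn_cpt (fun v => contDiffOn_fderiv_apply hD hf v) a

/-- Symmetry of the real second derivative, extended to the complex frame by bilinearity. -/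
theorem pd_pd_comm {D : Set C2} (hD : IsOpen D) {f : C2 → W} (hf : ContDiffOn ℝ ∞ f D) {z : C2}
    (hz : z ∈ D) (a b : Idx) : pd a (pd b f) z = pd b (pd a f) z := by
  have hd : ∀ v, DifferentiableAt ℝ (fun z => fderiv ℝ f z v) z := fun v =>
    differentiableAt_of_isOpen hD (contDiffOn_fderiv_apply hD hf v) hz
  have hd1 : DifferentiableAt ℝ (fderiv ℝ f) z :=
    ((hf.fderiv_of_isOpen hD (m := ∞) (by simp)).contDiffAt (hD.mem_nhds hz)).differentiableAt
      (by simp)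
  have key : ∀ u v, fderiv ℝ (fun z => fderiv ℝ f z v) z u
      = fderiv ℝ (fun z => fderiv ℝ f z u) z v := by
    intro u v
    have e : ∀ u v, fderiv ℝ (fun z => fderiv ℝ f z v) z u = fderiv ℝ (fderiv ℝ f) z u v := by
      intro u v
      rw [fderiv_clm_apply hd1 (by fun_prop)]
      simp
    rw [e, e]
    have hs : IsSymmSndFDerivAt ℝ f z :=
      (hf.contDiffAt (hD.mem_nhds hz)).isSymmSndFDerivAt (by
        simpa using WithTop.coe_le_coe.2 (le_top (a := (2 : ℕ∞))))
    exact hs u v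
  have e : ∀ a b, pd a (pd b f) z = cpt (fun u => cpt (fun v =>
      fderiv ℝ (fun z => fderiv ℝ f z v) z u) b) a := by
    intro a b
    unfold pd
    congr 1
    funext u
    exact fderiv_cpt hd b u
  rw [e, e]
  simp only [cpt_eq, smul_add]
  rw [key (base a) (base b), key (base a) (Complex.I • base b),
    key (Complex.I • base a) (base b), key (Complex.I • base a) (Complex.I • base b)]
  module

end Smooth

/-! ### The product rules for scalar multiplication and conjugation -/

theorem pd_conj (a : Idx) (f : C2 → ℂ) (z : C2) :
    pd (bar a) (fun w => conj (f w)) z = conj (pd a f z) := by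
  have h : ∀ v, fderiv ℝ (fun w => conj (f w)) z v = conj (fderiv ℝ f z v) := by
    intro v
    have := (Complex.conjCLE.comp_fderiv (f := f) (x := z))
    exact congrArg (fun L => L v) this
  simp only [pd_eq, h, base_bar, frameSign_bar, smul_eq_mul, map_mul, map_add, map_div₀, map_one,
    map_ofNat]

section Smul

variable {W : Type*} [NormedAddCommGroup W] [NormedSpace ℝ W] [Module ℂ W]
  [SMulCommClass ℝ ℂ W] [IsScalarTower ℝ ℂ W]

/-- Complex scalar multiplication as a real bilinear map. -/
def smulBilin (W : Type*) [NormedAddCommGroup W] [NormedSpace ℝ W] [Module ℂ W]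
    [SMulCommClass ℝ ℂ W] [IsScalarTower ℝ ℂ W] : ℂ →ₗ[ℝ] W →ₗ[ℝ] W :=
  LinearMap.mk₂ ℝ (fun c x => c • x) (fun _ _ _ => add_smul _ _ _) (fun _ _ _ => smul_assoc _ _ _)
    (fun _ _ _ => smul_add _ _ _) (fun _ _ _ => smul_comm _ _ _)

variable [FiniteDimensional ℝ W]

theorem pd_smul (a : Idx) {c : C2 → ℂ} {f : C2 → W} {z : C2} (hc : DifferentiableAt ℝ c z)
    (hf : DifferentiableAt ℝ f z) :
    pd a (fun w => c w • f w) z = pd a c z • f z + c z • pd a f z :=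
  pd_bilin (smulBilin W) (fun c x y => smul_assoc c x y) (fun c x y => smul_comm x c y) a hc hf

theorem pd_mul (a : Idx) {c f : C2 → ℂ} {z : C2} (hc : DifferentiableAt ℝ c z)
    (hf : DifferentiableAt ℝ f z) :
    pd a (fun w => c w * f w) z = pd a c z * f z + c z * pd a f z :=
  pd_smul a hc hf

theorem pd_const_smul (a : Idx) (c : ℂ) {f : C2 → W} {z : C2} (hf : DifferentiableAt ℝ f z) :
    pd a (fun w => c • f w) z = c • pd a f z := by
  rw [pd_smul a (differentiableAt_const c) hf]
  simp

theorem contDiffOn_csmul {n : ℕ∞ω} {D : Set C2} {c : C2 → ℂ} {f : C2 → W}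
    (hc : ContDiffOn ℝ n c D) (hf : ContDiffOn ℝ n f D) :
    ContDiffOn ℝ n (fun w => c w • f w) D :=
  contDiffOn_bilin (smulBilin W) hc hf

theorem pd_inv (a : Idx) {c : C2 → ℂ} {z : C2} (hc : DifferentiableAt ℝ c z) (h0 : c z ≠ 0) :
    pd a (fun w => (c w)⁻¹) z = -(c z)⁻¹ * (c z)⁻¹ * pd a c z := by
  -- Differentiating `c⁻¹ c = 1` reduces the claim to the product rule.
  have h : (fun w => (c w)⁻¹ * c w) =ᶠ[𝓝 z] fun _ => 1 := by
    filter_upwards [hc.continuousAt.eventually_ne h0] with w hw using inv_mul_cancel₀ hw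
  have h1 := pd_congr h a
  rw [pd_mul a (c := fun w => (c w)⁻¹) (hc.inv h0) hc, pd_const] at h1
  field_simp at h1 ⊢
  linear_combination h1

end Smul

theorem pd_ofReal (a : Idx) {f : C2 → ℝ} {z : C2} (hf : DifferentiableAt ℝ f z) :
    pd a (fun w => (f w : ℂ)) z = (1 / 2 : ℂ) * ((fderiv ℝ f z (base a) : ℂ)
      + frameSign a * (fderiv ℝ f z (Complex.I • base a) : ℂ)) := by
  have h : ∀ v, fderiv ℝ (fun w => (f w : ℂ)) z v = (fderiv ℝ f z v : ℂ) := by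
    intro v
    have := (Complex.ofRealCLM.hasFDerivAt.comp z hf.hasFDerivAt).fderiv
    exact congrArg (fun L => L v) this
  simp only [pd_eq, h, smul_eq_mul]

theorem contDiffOn_ofReal {D : Set C2} {f : C2 → ℝ} (hf : ContDiffOn ℝ ∞ f D) :
    ContDiffOn ℝ ∞ (fun z => (f z : ℂ)) D :=
  Complex.ofRealCLM.contDiff.comp_contDiffOn hf

/-! ### Linear algebra of a hermitian metric in the complex frame. -/

namespace Patch

variable {V : Type*}

/-- The metric of the patch is a smooth Kähler metric on the open set `D`. -/
structure IsKahlerMetric (P : Patch V) : Prop where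
  isOpen : IsOpen P.D
  smooth : ∀ v w, ContDiffOn ℝ ∞ (fun z => P.g z v w) P.D
  add_left : ∀ z ∈ P.D, ∀ u v w, P.g z (u + v) w = P.g z u w + P.g z v w
  smul_left : ∀ z ∈ P.D, ∀ (r : ℝ) v w, P.g z (r • v) w = r * P.g z v w
  symm : ∀ z ∈ P.D, ∀ v w, P.g z v w = P.g z w v
  pos : ∀ z ∈ P.D, ∀ v, v ≠ 0 → 0 < P.g z v v
  invariant : ∀ z ∈ P.D, ∀ v w, P.g z (Complex.I • v) (Complex.I • w) = P.g z v w
  closed : ∀ z ∈ P.D, ∀ u v w,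
    fderiv ℝ (fun y => P.g y (Complex.I • v) w) z u
      + fderiv ℝ (fun y => P.g y (Complex.I • w) u) z v
      + fderiv ℝ (fun y => P.g y (Complex.I • u) v) z w = 0

/-- The components `g(∂_μ, ∂_ν̄)`. -/
def herm (P : Patch V) (μ ν : Fin 2) (z : C2) : ℂ := P.gLow z (Sum.inl μ) (Sum.inr ν)

/-- The determinant of the matrix `g_{μν̄}`. -/
def hermDet (P : Patch V) (z : C2) : ℂ :=
  P.herm 0 0 z * P.herm 1 1 z - P.herm 0 1 z * P.herm 1 0 z

/-- The adjugate of the matrix `g_{μν̄}`. -/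
def cof (P : Patch V) : Fin 2 → Fin 2 → C2 → ℂ :=
  ![![fun z => P.herm 1 1 z, fun z => -P.herm 0 1 z],
    ![fun z => -P.herm 1 0 z, fun z => P.herm 0 0 z]]

/-- The logarithmic derivative `∂_ν̄ log det g`. -/
def gam (P : Patch V) (ν : Fin 2) (z : C2) : ℂ :=
  (P.hermDet z)⁻¹ * pd (Sum.inr ν) P.hermDet z

variable {P : Patch V}

namespace IsKahlerMetric

variable (hP : P.IsKahlerMetric) {z : C2} (hz : z ∈ P.D)
include hP hz

theorem neg_left (v w : C2) : P.g z (-v) w = -P.g z v w := by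
  have := hP.smul_left z hz (-1) v w
  simpa using this

theorem neg_right (v w : C2) : P.g z v (-w) = -P.g z v w := by
  rw [hP.symm z hz, hP.neg_left hz, hP.symm z hz]

/-- An isometry `J` with `J² = -1` is skew. Used as a rewrite rule, this moves every `J` into the
second slot. -/
theorem rot_left (v w : C2) : P.g z (Complex.I • v) w = -P.g z v (Complex.I • w) := by
  have h := hP.invariant z hz (Complex.I • v) w
  rw [smul_smul, Complex.I_mul_I, neg_one_smul, hP.neg_left hz] at h
  linarith

/-- Both coefficients vanish when `a` and `b` are of the same type, which is why the metric only has
mixed components. -/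
theorem gLow_eq (a b : Idx) : P.gLow z a b = (1 / 4 : ℂ) *
    ((1 + frameSign a * frameSign b) * (P.g z (base a) (base b) : ℂ)
      + (frameSign b - frameSign a) * (P.g z (base a) (Complex.I • base b) : ℂ)) := by
  simp only [gLow, cpt₂, cpt_eq, smul_eq_mul, hP.rot_left hz, smul_smul, Complex.I_mul_I,
    neg_one_smul, hP.neg_right hz]
  push_cast
  ring

/-- `∂_a` is an eigenvector of `J` with eigenvalue `-frameSign a`. -/
theorem omega_eq (a b : Idx) : P.omega z a b = -frameSign a * P.gLow z a b := by
  rw [hP.gLow_eq hz]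
  simp only [omega, cpt₂, kahlerForm, cpt_eq, smul_eq_mul, hP.rot_left hz, smul_smul,
    Complex.I_mul_I, neg_one_smul, hP.neg_right hz]
  have : frameSign a * frameSign a = -1 := by cases a <;> simp [frameSign]
  push_cast
  linear_combination (1 / 4 : ℂ) * (frameSign b * (P.g z (base a) (base b) : ℂ)
    - (P.g z (base a) (Complex.I • base b) : ℂ)) * this

theorem gLow_symm (a b : Idx) : P.gLow z a b = P.gLow z b a := by
  rw [hP.gLow_eq hz, hP.gLow_eq hz, hP.symm z hz (base a) (base b),
    ← neg_neg (P.g z (base a) (Complex.I • base b)), ← hP.rot_left hz,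
    hP.symm z hz _ (base b)]
  push_cast
  ring

theorem gLow_inl_inl (μ ν : Fin 2) : P.gLow z (Sum.inl μ) (Sum.inl ν) = 0 := by
  simp [hP.gLow_eq hz, frameSign]

theorem gLow_inr_inr (μ ν : Fin 2) : P.gLow z (Sum.inr μ) (Sum.inr ν) = 0 := by
  simp [hP.gLow_eq hz, frameSign]

omit hP hz in
theorem gLow_inl_inr (μ ν : Fin 2) : P.gLow z (Sum.inl μ) (Sum.inr ν) = P.herm μ ν z := rfl

theorem gLow_inr_inl (μ ν : Fin 2) : P.gLow z (Sum.inr ν) (Sum.inl μ) = P.herm μ ν z :=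
  hP.gLow_symm hz _ _

theorem herm_eq (μ ν : Fin 2) : P.herm μ ν z = (1 / 2 : ℂ) *
    ((P.g z (stdVec μ) (stdVec ν) : ℂ)
      + Complex.I * (P.g z (stdVec μ) (Complex.I • stdVec ν) : ℂ)) := by
  rw [herm, hP.gLow_eq hz]
  simp only [frameSign, base, Sum.elim_inl, Sum.elim_inr, neg_mul, Complex.I_mul_I]
  ring

theorem conj_herm (μ ν : Fin 2) : conj (P.herm μ ν z) = P.herm ν μ z := by
  rw [hP.herm_eq hz, hP.herm_eq hz, hP.symm z hz (stdVec ν) (Complex.I • stdVec μ),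
    hP.rot_left hz, hP.symm z hz (stdVec ν)]
  simp only [map_mul, map_add, map_div₀, map_one, map_ofNat, Complex.conj_ofReal, Complex.conj_I]
  push_cast
  ring

/-- Gram–Schmidt: up to positive factors the determinant is the squared length of the part of `e_0`
orthogonal to the complex line through `e_1`. -/
theorem hermDet_pos : ∃ d : ℝ, 0 < d ∧ P.hermDet z = d := by
  set p := P.g z (stdVec 0) (stdVec 0) with hp
  set q := P.g z (stdVec 1) (stdVec 1) with hq
  set r := P.g z (stdVec 0) (stdVec 1) with hr
  set s := P.g z (stdVec 0) (Complex.I • stdVec 1) with hs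
  have hself : ∀ v, P.g z v (Complex.I • v) = 0 := by
    intro v
    have h1 := hP.rot_left hz v v
    rw [hP.symm z hz] at h1
    linarith
  have hq0 : 0 < q := hP.pos z hz _ (by
    intro h
    have := congrFun h 1
    simp [stdVec] at this)
  have h10 : P.herm 1 0 z = (1 / 2 : ℂ) * (r - Complex.I * s) := by
    rw [← hP.conj_herm hz, hP.herm_eq hz, ← hr, ← hs]
    simp only [map_mul, map_add, map_div₀, map_one, map_ofNat, Complex.conj_ofReal,
      Complex.conj_I]
    ring
  refine ⟨(p * q - r ^ 2 - s ^ 2) / 4, ?_, ?_⟩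
  · have add_right : ∀ u v w, P.g z u (v + w) = P.g z u v + P.g z u w := by
      intro u v w
      rw [hP.symm z hz, hP.add_left z hz, hP.symm z hz v, hP.symm z hz w]
    have smul_right : ∀ (t : ℝ) v w, P.g z v (t • w) = t * P.g z v w := by
      intro t v w
      rw [hP.symm z hz, hP.smul_left z hz, hP.symm z hz w]
    -- This vector is `q` times that orthogonal part, as `e_1` and `J e_1` are orthogonal with
    -- squared length `q`. Its own squared length is `q (p q - r² - s²)`.
    have hw := hP.pos z hz (q • stdVec 0 + ((-r) • stdVec 1 + (-s) • (Complex.I • stdVec 1))) (by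
      intro h
      have := congrFun h 0
      simp [stdVec] at this
      exact hq0.ne' this)
    have e1 : P.g z (stdVec 1) (stdVec 0) = r := hP.symm z hz _ _
    have e2 : P.g z (Complex.I • stdVec 1) (stdVec 0) = s := hP.symm z hz _ _
    have e3 : P.g z (Complex.I • stdVec 1) (stdVec 1) = 0 := by
      rw [hP.symm z hz]; exact hself _
    simp only [hP.add_left z hz, add_right, hP.smul_left z hz, smul_right, hself, hP.invariant z hz,
      e1, e2, e3, ← hp, ← hq, ← hr, ← hs] at hw
    have : 0 < q * (p * q - r ^ 2 - s ^ 2) := by nlinarith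
    have := (mul_pos_iff_of_pos_left hq0).1 this
    linarith
  · rw [hermDet, h10, hP.herm_eq hz, hP.herm_eq hz, hP.herm_eq hz, hself, hself, ← hp, ← hq, ← hr,
      ← hs]
    push_cast
    linear_combination (1 / 4 : ℂ) * (s : ℂ) ^ 2 * Complex.I_sq

theorem hermDet_ne : P.hermDet z ≠ 0 := by
  obtain ⟨d, hd, e⟩ := hP.hermDet_pos hz
  rw [e]
  exact_mod_cast hd.ne'

theorem conj_hermDet : conj (P.hermDet z) = P.hermDet z := by
  obtain ⟨d, hd, e⟩ := hP.hermDet_pos hz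
  rw [e, Complex.conj_ofReal]

theorem conj_cof (μ ν : Fin 2) : conj (P.cof μ ν z) = P.cof ν μ z := by
  fin_cases μ <;> fin_cases ν <;> simp [cof, hP.conj_herm hz]

/-- The metric matrix is block antidiagonal, so its inverse is too, with blocks given by adjugate
over determinant. -/
theorem gUp_eq : Matrix.of (P.gUp z) = Matrix.fromBlocks 0
    (Matrix.of fun μ ν => (P.hermDet z)⁻¹ * P.cof ν μ z)
    (Matrix.of fun ν μ => (P.hermDet z)⁻¹ * P.cof ν μ z) 0 := by
  refine Matrix.inv_eq_right_inv ?_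
  have h0 := hP.hermDet_ne hz
  ext a b
  rw [Matrix.mul_apply]
  simp only [Fintype.sum_sum_type, Fin.sum_univ_two, Matrix.of_apply]
  rcases a with μ | μ <;> rcases b with ν | ν <;> fin_cases μ <;> fin_cases ν <;>
    simp [hP.gLow_inl_inl hz, hP.gLow_inr_inr hz, hP.gLow_inr_inl hz, gLow_inl_inr, cof] <;>
    field_simp <;> rw [hermDet] <;> ring

theorem gUp_inl_inl (μ ν : Fin 2) : P.gUp z (Sum.inl μ) (Sum.inl ν) = 0 :=
  congrFun (congrFun (hP.gUp_eq hz) (Sum.inl μ)) (Sum.inl ν)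

theorem gUp_inr_inr (μ ν : Fin 2) : P.gUp z (Sum.inr μ) (Sum.inr ν) = 0 :=
  congrFun (congrFun (hP.gUp_eq hz) (Sum.inr μ)) (Sum.inr ν)

theorem gUp_inl_inr (μ ν : Fin 2) :
    P.gUp z (Sum.inl μ) (Sum.inr ν) = (P.hermDet z)⁻¹ * P.cof ν μ z :=
  congrFun (congrFun (hP.gUp_eq hz) (Sum.inl μ)) (Sum.inr ν)

theorem gUp_inr_inl (μ ν : Fin 2) :
    P.gUp z (Sum.inr ν) (Sum.inl μ) = (P.hermDet z)⁻¹ * P.cof ν μ z :=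
  congrFun (congrFun (hP.gUp_eq hz) (Sum.inr ν)) (Sum.inl μ)

/-- The metric matrix has off-diagonal blocks `B` and `Bᵀ`, so its determinant has modulus `(det
B)²`, and `det B` is positive. -/
theorem vol_eq : (P.vol z : ℂ) = 4 * P.hermDet z := by
  obtain ⟨d, hd, e⟩ := hP.hermDet_pos hz
  let B : Matrix (Fin 2) (Fin 2) ℂ := Matrix.of fun μ ν => P.herm μ ν z
  -- Exchanging barred and unbarred indices makes the matrix block diagonal; `T² = 1` shows that
  -- this does not change the modulus of the determinant.
  let T : Matrix Idx Idx ℂ := Matrix.fromBlocks 0 1 1 0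
  have hB : B.det = d := by
    rw [Matrix.det_fin_two, ← e]
    rfl
  have h1 : Matrix.of (P.gLow z) = Matrix.fromBlocks 0 B B.transpose 0 := by
    ext a b
    rcases a with μ | μ <;> rcases b with ν | ν
    · exact hP.gLow_inl_inl hz μ ν
    · rfl
    · exact hP.gLow_inr_inl hz ν μ
    · exact hP.gLow_inr_inr hz μ ν
  have h2 : Matrix.of (P.gLow z) * T = Matrix.fromBlocks B 0 0 B.transpose := by
    rw [h1, Matrix.fromBlocks_multiply]
    simp
  have h3 : T * T = 1 := by
    simp only [T, Matrix.fromBlocks_multiply]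
    simp
  have h4 : ‖T.det‖ = 1 := by
    have := congrArg (fun A => ‖Matrix.det A‖) h3
    simp only [Matrix.det_mul, norm_mul, Matrix.det_one, norm_one] at this
    nlinarith [norm_nonneg T.det]
  have h5 := congrArg (fun A => ‖Matrix.det A‖) h2
  simp only [Matrix.det_mul, norm_mul, h4, mul_one, Matrix.det_fromBlocks_zero₂₁,
    Matrix.det_transpose, hB, Complex.norm_real, Real.norm_eq_abs, abs_of_pos hd] at h5
  rw [vol, h5, Real.sqrt_mul_self hd.le, e]
  push_cast
  rfl

end IsKahlerMetric

end Patch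

/-! ### Smoothness of the metric data and the Kähler condition in coordinates. -/

namespace Patch

variable {V : Type*} {P : Patch V}

namespace IsKahlerMetric

variable (hP : P.IsKahlerMetric)
include hP

theorem smooth_gLow (a b : Idx) : ContDiffOn ℝ ∞ (fun z => P.gLow z a b) P.D :=
  contDiffOn_cpt (fun v => contDiffOn_cpt (fun w => contDiffOn_ofReal (hP.smooth v w)) b) a

theorem smooth_herm (μ ν : Fin 2) : ContDiffOn ℝ ∞ (P.herm μ ν) P.D :=
  hP.smooth_gLow _ _

theorem smooth_hermDet : ContDiffOn ℝ ∞ P.hermDet P.D :=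
  ((hP.smooth_herm 0 0).mul (hP.smooth_herm 1 1)).sub
    ((hP.smooth_herm 0 1).mul (hP.smooth_herm 1 0))

theorem smooth_hermDet_inv : ContDiffOn ℝ ∞ (fun z => (P.hermDet z)⁻¹) P.D :=
  hP.smooth_hermDet.inv fun _ hz => hP.hermDet_ne hz

theorem smooth_cof (μ ν : Fin 2) : ContDiffOn ℝ ∞ (P.cof μ ν) P.D := by
  fin_cases μ <;> fin_cases ν
  · exact hP.smooth_herm 1 1
  · exact (hP.smooth_herm 0 1).neg
  · exact (hP.smooth_herm 1 0).neg
  · exact hP.smooth_herm 0 0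

theorem smooth_gam (ν : Fin 2) : ContDiffOn ℝ ∞ (P.gam ν) P.D :=
  hP.smooth_hermDet_inv.mul (contDiffOn_pd hP.isOpen hP.smooth_hermDet _)

variable {z : C2} (hz : z ∈ P.D)
include hz

theorem diff_herm (μ ν : Fin 2) : DifferentiableAt ℝ (P.herm μ ν) z :=
  differentiableAt_of_isOpen hP.isOpen (hP.smooth_herm μ ν) hz

theorem diff_hermDet : DifferentiableAt ℝ P.hermDet z :=
  differentiableAt_of_isOpen hP.isOpen hP.smooth_hermDet hz

theorem diff_hermDet_inv : DifferentiableAt ℝ (fun z => (P.hermDet z)⁻¹) z :=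
  differentiableAt_of_isOpen hP.isOpen hP.smooth_hermDet_inv hz

theorem diff_cof (μ ν : Fin 2) : DifferentiableAt ℝ (P.cof μ ν) z :=
  differentiableAt_of_isOpen hP.isOpen (hP.smooth_cof μ ν) hz

theorem diff_gam (ν : Fin 2) : DifferentiableAt ℝ (P.gam ν) z :=
  differentiableAt_of_isOpen hP.isOpen (hP.smooth_gam ν) hz

theorem fderiv_rot_left (u v w : C2) : fderiv ℝ (fun y => P.g y (Complex.I • v) w) z u
    = -fderiv ℝ (fun y => P.g y v (Complex.I • w)) z u := by
  have h : (fun y => P.g y (Complex.I • v) w) =ᶠ[𝓝 z] fun y => -P.g y v (Complex.I • w) :=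
    Filter.eventually_of_mem (hP.isOpen.mem_nhds hz) fun y hy => hP.rot_left hy v w
  rw [h.fderiv_eq, fderiv_fun_neg]
  rfl

theorem fderiv_symm (u v w : C2) : fderiv ℝ (fun y => P.g y v w) z u
    = fderiv ℝ (fun y => P.g y w v) z u := by
  have h : (fun y => P.g y v w) =ᶠ[𝓝 z] fun y => P.g y w v :=
    Filter.eventually_of_mem (hP.isOpen.mem_nhds hz) fun y hy => hP.symm y hy v w
  rw [h.fderiv_eq]

theorem fderiv_invariant (u v w : C2) :
    fderiv ℝ (fun y => P.g y (Complex.I • v) (Complex.I • w)) z u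
      = fderiv ℝ (fun y => P.g y v w) z u := by
  have h : (fun y => P.g y (Complex.I • v) (Complex.I • w)) =ᶠ[𝓝 z] fun y => P.g y v w :=
    Filter.eventually_of_mem (hP.isOpen.mem_nhds hz) fun y hy => hP.invariant y hy v w
  rw [h.fderiv_eq]

theorem fderiv_neg_left (u v w : C2) : fderiv ℝ (fun y => P.g y (-v) w) z u
    = -fderiv ℝ (fun y => P.g y v w) z u := by
  have h : (fun y => P.g y (-v) w) =ᶠ[𝓝 z] fun y => -P.g y v w :=
    Filter.eventually_of_mem (hP.isOpen.mem_nhds hz) fun y hy => hP.neg_left hy v w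
  rw [h.fderiv_eq, fderiv_fun_neg]
  rfl

/-- Obtained from `dω = 0` on `(u, Jv, w)` and on `(Ju, v, w)`. With `closed_im` these are, up to
factors, the real and imaginary parts of the symmetry of `∂_l g_{μν̄}` in `l` and `μ`. -/
theorem closed_re (u v w : C2) :
    fderiv ℝ (fun y => P.g y v w) z u
      + fderiv ℝ (fun y => P.g y v (Complex.I • w)) z (Complex.I • u)
    = fderiv ℝ (fun y => P.g y u w) z v
      + fderiv ℝ (fun y => P.g y u (Complex.I • w)) z (Complex.I • v) := by
  have h1 := hP.closed z hz u (Complex.I • v) w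
  have h2 := hP.closed z hz (Complex.I • u) v w
  simp only [smul_smul, Complex.I_mul_I, neg_one_smul, hP.fderiv_invariant hz,
    hP.fderiv_neg_left hz] at h1 h2
  rw [hP.fderiv_symm hz (Complex.I • v) _ u] at h1
  rw [hP.fderiv_symm hz v w u, hP.fderiv_rot_left hz _ v w] at h2
  linarith

theorem closed_im (u v w : C2) :
    fderiv ℝ (fun y => P.g y v w) z (Complex.I • u)
      - fderiv ℝ (fun y => P.g y v (Complex.I • w)) z u
    = fderiv ℝ (fun y => P.g y u w) z (Complex.I • v)
      - fderiv ℝ (fun y => P.g y u (Complex.I • w)) z v := by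
  have h1 := hP.closed z hz u v w
  have h2 := hP.closed z hz (Complex.I • u) (Complex.I • v) w
  simp only [smul_smul, Complex.I_mul_I, neg_one_smul, hP.fderiv_invariant hz,
    hP.fderiv_neg_left hz] at h1 h2
  rw [hP.fderiv_rot_left hz u v w, hP.fderiv_symm hz v _ u, hP.fderiv_rot_left hz w u v] at h1
  rw [hP.fderiv_symm hz _ w u] at h2
  linarith

theorem pd_herm (a : Idx) (μ ν : Fin 2) : pd a (P.herm μ ν) z = (1 / 4 : ℂ) *
    (((fderiv ℝ (fun y => P.g y (stdVec μ) (stdVec ν)) z (base a) : ℂ)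
      + frameSign a
        * (fderiv ℝ (fun y => P.g y (stdVec μ) (stdVec ν)) z (Complex.I • base a) : ℂ))
    + Complex.I * ((fderiv ℝ (fun y => P.g y (stdVec μ) (Complex.I • stdVec ν)) z (base a) : ℂ)
      + frameSign a * (fderiv ℝ (fun y => P.g y (stdVec μ) (Complex.I • stdVec ν)) z
        (Complex.I • base a) : ℂ))) := by
  have hd : ∀ v w, DifferentiableAt ℝ (fun y => P.g y v w) z := fun v w =>
    differentiableAt_of_isOpen hP.isOpen (hP.smooth v w) hz
  have hdc : ∀ v w, DifferentiableAt ℝ (fun y => (P.g y v w : ℂ)) z := fun v w =>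
    differentiableAt_of_isOpen hP.isOpen (contDiffOn_ofReal (hP.smooth v w)) hz
  have hdi : DifferentiableAt ℝ
      (fun y => Complex.I • (P.g y (stdVec μ) (Complex.I • stdVec ν) : ℂ)) z :=
    (hdc _ _).const_smul Complex.I
  have hds : DifferentiableAt ℝ (fun y => (P.g y (stdVec μ) (stdVec ν) : ℂ)
      + Complex.I • (P.g y (stdVec μ) (Complex.I • stdVec ν) : ℂ)) z := (hdc _ _).add hdi
  have h := pd_congr_on hP.isOpen (fun y hy => hP.herm_eq hy μ ν) hz a
  simp only [← smul_eq_mul] at h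
  rw [h, pd_const_smul a _ hds, pd_add a (hdc _ _) hdi, pd_const_smul a _ (hdc _ _),
    pd_ofReal a (hd _ _), pd_ofReal a (hd _ _)]
  simp only [smul_eq_mul]
  ring

/-- The Kähler condition in holomorphic coordinates. -/
theorem pd_herm_inl (l μ ν : Fin 2) :
    pd (Sum.inl l) (P.herm μ ν) z = pd (Sum.inl μ) (P.herm l ν) z := by
  rw [hP.pd_herm hz, hP.pd_herm hz]
  simp only [base, frameSign, Sum.elim_inl]
  have h1 := congrArg (fun t : ℝ => (t : ℂ)) (hP.closed_re hz (stdVec l) (stdVec μ) (stdVec ν))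
  have h2 := congrArg (fun t : ℝ => (t : ℂ)) (hP.closed_im hz (stdVec l) (stdVec μ) (stdVec ν))
  push_cast at h1 h2
  linear_combination (1 / 4 : ℂ) * h1 - (1 / 4 : ℂ) * Complex.I * h2
    - (1 / 4 : ℂ) * ((fderiv ℝ (fun y => P.g y (stdVec μ) (Complex.I • stdVec ν)) z
        (Complex.I • stdVec l) : ℂ) - (fderiv ℝ (fun y => P.g y (stdVec l)
          (Complex.I • stdVec ν)) z (Complex.I • stdVec μ) : ℂ)) * Complex.I_sq

theorem pd_herm_conj (l μ ν : Fin 2) :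
    pd (Sum.inr l) (P.herm μ ν) z = conj (pd (Sum.inl l) (P.herm ν μ) z) := by
  rw [← pd_conj]
  exact pd_congr_on hP.isOpen (fun y hy => (hP.conj_herm hy ν μ).symm) hz _

theorem pd_herm_inr (l μ ν : Fin 2) :
    pd (Sum.inr l) (P.herm μ ν) z = pd (Sum.inr ν) (P.herm μ l) z := by
  rw [hP.pd_herm_conj hz, hP.pd_herm_conj hz, hP.pd_herm_inl hz]

theorem pd_hermDet (a : Idx) : pd a P.hermDet z =
    pd a (P.herm 0 0) z * P.herm 1 1 z + P.herm 0 0 z * pd a (P.herm 1 1) z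
      - (pd a (P.herm 0 1) z * P.herm 1 0 z + P.herm 0 1 z * pd a (P.herm 1 0) z) := by
  have hd := hP.diff_herm hz
  rw [← pd_mul a (hd _ _) (hd _ _), ← pd_mul a (hd _ _) (hd _ _)]
  exact pd_sub a ((hd _ _).mul (hd _ _)) ((hd _ _).mul (hd _ _))

/-- Cofactors of a `2 × 2` matrix are its entries up to sign, so vanishing divergence is exactly the
Kähler symmetry of the first derivatives. -/
theorem sum_pd_cof_inr (μ : Fin 2) : ∑ ν, pd (Sum.inr ν) (P.cof ν μ) z = 0 := by
  rw [Fin.sum_univ_two]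
  fin_cases μ
  · have h : pd (Sum.inr 1) (P.cof 1 0) z = -pd (Sum.inr 1) (P.herm 1 0) z := pd_neg _ _ _
    change pd (Sum.inr 0) (P.herm 1 1) z + pd (Sum.inr 1) (P.cof 1 0) z = 0
    rw [h, hP.pd_herm_inr hz 0]
    ring
  · have h : pd (Sum.inr 0) (P.cof 0 1) z = -pd (Sum.inr 0) (P.herm 0 1) z := pd_neg _ _ _
    change pd (Sum.inr 0) (P.cof 0 1) z + pd (Sum.inr 1) (P.herm 0 0) z = 0
    rw [h, hP.pd_herm_inr hz 0]
    ring

theorem sum_pd_cof_inl (ν : Fin 2) : ∑ μ, pd (Sum.inl μ) (P.cof ν μ) z = 0 := by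
  rw [Fin.sum_univ_two]
  fin_cases ν
  · have h : pd (Sum.inl 1) (P.cof 0 1) z = -pd (Sum.inl 1) (P.herm 0 1) z := pd_neg _ _ _
    change pd (Sum.inl 0) (P.herm 1 1) z + pd (Sum.inl 1) (P.cof 0 1) z = 0
    rw [h, hP.pd_herm_inl hz 0]
    ring
  · have h : pd (Sum.inl 0) (P.cof 1 0) z = -pd (Sum.inl 0) (P.herm 1 0) z := pd_neg _ _ _
    change pd (Sum.inl 0) (P.cof 1 0) z + pd (Sum.inl 1) (P.herm 0 0) z = 0
    rw [h, hP.pd_herm_inl hz 0]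
    ring

/-! ### Christoffel symbols and Ricci curvature -/

theorem pd_gLow_inl_inl (a : Idx) (μ ν : Fin 2) :
    pd a (fun w => P.gLow w (Sum.inl μ) (Sum.inl ν)) z = 0 := by
  rw [pd_congr_on hP.isOpen (fun y hy => hP.gLow_inl_inl hy μ ν) hz, pd_const]

theorem pd_gLow_inr_inr (a : Idx) (μ ν : Fin 2) :
    pd a (fun w => P.gLow w (Sum.inr μ) (Sum.inr ν)) z = 0 := by
  rw [pd_congr_on hP.isOpen (fun y hy => hP.gLow_inr_inr hy μ ν) hz, pd_const]

theorem pd_gLow_inr_inl (a : Idx) (μ ν : Fin 2) :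
    pd a (fun w => P.gLow w (Sum.inr ν) (Sum.inl μ)) z = pd a (P.herm μ ν) z :=
  pd_congr_on hP.isOpen (fun _ hy => hP.gLow_inr_inl hy μ ν) hz a

omit hP hz in
theorem pd_gLow_inl_inr (a : Idx) (μ ν : Fin 2) :
    pd a (fun w => P.gLow w (Sum.inl μ) (Sum.inr ν)) z = pd a (P.herm μ ν) z := rfl

theorem Gam_symm (c a b : Idx) : P.Gam z c a b = P.Gam z c b a := by
  unfold Gam
  congr 1
  refine Finset.sum_congr rfl fun d _ => ?_
  rw [pd_congr_on hP.isOpen (fun y hy => hP.gLow_symm hy a b) hz]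
  ring

/-- The Levi-Civita connection of a Kähler metric preserves type: only unbarred `d` survive in the
contraction, and for them the two mixed derivatives cancel by the Kähler symmetry. -/
theorem Gam_inr_inl (l μ : Fin 2) (a : Idx) : P.Gam z (Sum.inr l) a (Sum.inl μ) = 0 := by
  unfold Gam
  rw [Fintype.sum_sum_type]
  simp only [hP.gUp_inr_inr hz, zero_mul, Finset.sum_const_zero, add_zero]
  rw [Finset.sum_eq_zero, mul_zero]
  intro ρ _
  cases a with
  | inl α => simp [hP.pd_gLow_inl_inl hz]
  | inr α =>
    rw [hP.pd_gLow_inl_inl hz, hP.pd_gLow_inr_inl hz, hP.pd_gLow_inr_inl hz,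
      hP.pd_herm_inl hz μ ρ α]
    ring

theorem Gam_inr_inl_left (l μ : Fin 2) (b : Idx) : P.Gam z (Sum.inr l) (Sum.inl μ) b = 0 := by
  rw [hP.Gam_symm hz, hP.Gam_inr_inl hz]

theorem Gam_inl_inr (l σ : Fin 2) (a : Idx) : P.Gam z (Sum.inl l) a (Sum.inr σ) = 0 := by
  unfold Gam
  rw [Fintype.sum_sum_type]
  simp only [hP.gUp_inl_inl hz, zero_mul, Finset.sum_const_zero, zero_add]
  rw [Finset.sum_eq_zero, mul_zero]
  intro ρ _
  cases a with
  | inr α => simp [hP.pd_gLow_inr_inr hz]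
  | inl α =>
    rw [hP.pd_gLow_inr_inr hz, pd_gLow_inl_inr, pd_gLow_inl_inr, hP.pd_herm_inr hz ρ α σ]
    ring

theorem Gam_inr_inr_inr (l τ σ : Fin 2) : P.Gam z (Sum.inr l) (Sum.inr τ) (Sum.inr σ)
    = ∑ ρ, (P.hermDet z)⁻¹ * P.cof l ρ z * pd (Sum.inr τ) (P.herm ρ σ) z := by
  unfold Gam
  rw [Fintype.sum_sum_type]
  simp only [hP.gUp_inr_inr hz, zero_mul, Finset.sum_const_zero, add_zero, hP.gUp_inr_inl hz,
    hP.pd_gLow_inr_inl hz, hP.pd_gLow_inr_inr hz]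
  rw [Finset.mul_sum]
  refine Finset.sum_congr rfl fun ρ _ => ?_
  rw [hP.pd_herm_inr hz σ ρ τ]
  ring

/-- Jacobi's formula `tr(h⁻¹ ∂h) = ∂ log det h`. -/
theorem sum_Gam_inr (τ : Fin 2) :
    ∑ l, P.Gam z (Sum.inr l) (Sum.inr τ) (Sum.inr l) = P.gam τ z := by
  simp only [hP.Gam_inr_inr_inr hz, Fin.sum_univ_two]
  rw [gam, hP.pd_hermDet hz]
  simp only [cof, Matrix.cons_val_zero, Matrix.cons_val_one]
  ring

theorem smooth_Gam_inr (l τ σ : Fin 2) :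
    DifferentiableAt ℝ (fun w => P.Gam w (Sum.inr l) (Sum.inr τ) (Sum.inr σ)) z := by
  refine differentiableAt_of_isOpen hP.isOpen (ContDiffOn.congr (f := fun w =>
    ∑ ρ, (P.hermDet w)⁻¹ * P.cof l ρ w * pd (Sum.inr τ) (P.herm ρ σ) w) ?_
    fun y hy => hP.Gam_inr_inr_inr hy l τ σ) hz
  exact ContDiffOn.sum fun ρ _ => (hP.smooth_hermDet_inv.mul (hP.smooth_cof l ρ)).mul
    (contDiffOn_pd hP.isOpen (hP.smooth_herm ρ σ) _)

/-- Preservation of type removes the quadratic terms and every derivative of a mixed symbol. Only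
`-∂_τ` of the trace `∑ Γ^{l̄}_{σ̄l̄}` is left, whence `Ric = -∂∂̄ log det h`. -/
theorem ricci_eq (τ σ : Fin 2) :
    P.ricci z (Sum.inl τ) (Sum.inr σ) = -pd (Sum.inl τ) (P.gam σ) z := by
  have e1 : ∀ l, P.riem z (Sum.inl l) (Sum.inr σ) (Sum.inl l) (Sum.inl τ) = 0 := by
    intro l
    unfold riem
    rw [pd_congr_on hP.isOpen (fun y hy => hP.Gam_inl_inr hy l σ (Sum.inl τ)) hz,
      pd_congr_on hP.isOpen (fun y hy => hP.Gam_inl_inr hy l σ (Sum.inl l)) hz,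
      Fintype.sum_sum_type]
    simp [hP.Gam_inl_inr hz, hP.Gam_inr_inl_left hz]
  have e2 : ∀ l, P.riem z (Sum.inr l) (Sum.inr σ) (Sum.inr l) (Sum.inl τ)
      = -pd (Sum.inl τ) (fun w => P.Gam w (Sum.inr l) (Sum.inr σ) (Sum.inr l)) z := by
    intro l
    unfold riem
    rw [pd_congr_on hP.isOpen (fun y hy => hP.Gam_inr_inl_left hy l τ (Sum.inr σ)) hz,
      pd_congr_on hP.isOpen (fun y hy => hP.Gam_symm hy (Sum.inr l) (Sum.inr l) (Sum.inr σ)) hz,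
      Fintype.sum_sum_type]
    simp [hP.Gam_inl_inr hz, hP.Gam_inr_inl_left hz]
  rw [ricci, Fintype.sum_sum_type]
  simp only [e1, e2, Finset.sum_const_zero, zero_add, Finset.sum_neg_distrib]
  rw [← pd_sum _ _ fun l _ => hP.smooth_Gam_inr hz l σ l]
  rw [pd_congr_on hP.isOpen (fun y hy => hP.sum_Gam_inr hy σ) hz]

theorem S_eq : 2 * P.S z
    = -((P.hermDet z)⁻¹ * ∑ σ, ∑ τ, P.cof σ τ z * pd (Sum.inl τ) (P.gam σ) z) := by
  rw [S]
  simp only [hP.ricci_eq hz, hP.gUp_inr_inl hz, Fin.sum_univ_two]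
  ring

end IsKahlerMetric

end Patch

/-! ### The complexified Lie algebra and the coupled covariant derivative. -/

/-- Complex conjugation of `V ⊗ ℂ`. -/
def Cx.conj {V : Type*} [NormedAddCommGroup V] (x : Cx V) : Cx V := ((x.1, -x.2) : V × V)

theorem Cx.ofReal_fst {V : Type*} [NormedAddCommGroup V] (x : V) : (Cx.ofReal x).1 = x := rfl

theorem Cx.ofReal_snd {V : Type*} [NormedAddCommGroup V] (x : V) : (Cx.ofReal x).2 = 0 := rfl

theorem Cx.neg_fst {V : Type*} [NormedAddCommGroup V] (x : Cx V) : (-x).1 = -x.1 := rfl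

theorem Cx.neg_snd {V : Type*} [NormedAddCommGroup V] (x : Cx V) : (-x).2 = -x.2 := rfl

theorem contDiffOn_ofRealCx {V : Type*} [NormedAddCommGroup V] [NormedSpace ℝ V] {D : Set C2}
    {f : C2 → V} (hf : ContDiffOn ℝ ∞ f D) : ContDiffOn ℝ ∞ (fun z => Cx.ofReal (f z)) D :=
  (hf.prodMk contDiffOn_const : ContDiffOn ℝ ∞ (fun z => (f z, (0 : V))) D)

namespace Patch

variable {V : Type*} [NormedAddCommGroup V] [NormedSpace ℝ V] {P : Patch V}

/-- The bracket is a Lie bracket, and the inner product is a nondegenerate invariant symmetric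
bilinear form. -/
structure IsLieData (P : Patch V) : Prop where
  br_add : ∀ x y z, P.br (x + y) z = P.br x z + P.br y z
  br_smul : ∀ (r : ℝ) x y, P.br (r • x) y = r • P.br x y
  br_skew : ∀ x y, P.br x y = -P.br y x
  jacobi : ∀ x y z, P.br (P.br x y) z = P.br x (P.br y z) - P.br y (P.br x z)
  ip_add : ∀ x y z, P.ip (x + y) z = P.ip x z + P.ip y z
  ip_smul : ∀ (r : ℝ) x y, P.ip (r • x) y = r * P.ip x y
  ip_symm : ∀ x y, P.ip x y = P.ip y x
  ip_invariant : ∀ x y z, P.ip (P.br x y) z = -P.ip y (P.br x z)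
  ip_nondeg : ∀ y, (∀ x, P.ip x y = 0) → y = 0

omit [NormedSpace ℝ V] in
theorem brC_fst (x y : Cx V) : (P.brC x y).1 = P.br x.1 y.1 - P.br x.2 y.2 := rfl

omit [NormedSpace ℝ V] in
theorem brC_snd (x y : Cx V) : (P.brC x y).2 = P.br x.1 y.2 + P.br x.2 y.1 := rfl

namespace IsLieData

variable (hL : P.IsLieData)
include hL

theorem br_add_right (x y z : V) : P.br x (y + z) = P.br x y + P.br x z := by
  rw [hL.br_skew, hL.br_add, hL.br_skew y, hL.br_skew z]
  abel

theorem br_smul_right (r : ℝ) (x y : V) : P.br x (r • y) = r • P.br x y := by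
  rw [hL.br_skew, hL.br_smul, hL.br_skew y, smul_neg, neg_neg]

theorem br_neg (x y : V) : P.br (-x) y = -P.br x y := by
  simpa using hL.br_smul (-1) x y

theorem br_neg_right (x y : V) : P.br x (-y) = -P.br x y := by
  simpa using hL.br_smul_right (-1) x y

theorem br_sub (x y z : V) : P.br (x - y) z = P.br x z - P.br y z := by
  rw [sub_eq_add_neg, hL.br_add, hL.br_neg, sub_eq_add_neg]

theorem br_sub_right (x y z : V) : P.br x (y - z) = P.br x y - P.br x z := by
  rw [sub_eq_add_neg, hL.br_add_right, hL.br_neg_right, sub_eq_add_neg]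

theorem ip_add_right (x y z : V) : P.ip x (y + z) = P.ip x y + P.ip x z := by
  rw [hL.ip_symm, hL.ip_add, hL.ip_symm y, hL.ip_symm z]

theorem ip_smul_right (r : ℝ) (x y : V) : P.ip x (r • y) = r * P.ip x y := by
  rw [hL.ip_symm, hL.ip_smul, hL.ip_symm y]

theorem ip_neg (x y : V) : P.ip (-x) y = -P.ip x y := by
  simpa using hL.ip_smul (-1) x y

theorem ip_neg_right (x y : V) : P.ip x (-y) = -P.ip x y := by
  simpa using hL.ip_smul_right (-1) x y

theorem ip_sub (x y z : V) : P.ip (x - y) z = P.ip x z - P.ip y z := by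
  rw [sub_eq_add_neg, hL.ip_add, hL.ip_neg, sub_eq_add_neg]

theorem ip_sub_right (x y z : V) : P.ip x (y - z) = P.ip x y - P.ip x z := by
  rw [sub_eq_add_neg, hL.ip_add_right, hL.ip_neg_right, sub_eq_add_neg]

theorem brC_smul (c : ℂ) (x y : Cx V) : P.brC (c • x) y = c • P.brC x y := by
  refine Prod.ext ?_ ?_ <;>
    simp only [brC_fst, brC_snd, Cx.smul_fst, Cx.smul_snd, hL.br_sub, hL.br_add, hL.br_smul] <;>
    module

theorem brC_add (x y z : Cx V) : P.brC (x + y) z = P.brC x z + P.brC y z := by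
  refine Prod.ext ?_ ?_ <;>
    simp only [brC_fst, brC_snd, Cx.add_fst, Cx.add_snd, hL.br_add] <;> abel

theorem brC_skew (x y : Cx V) : P.brC x y = -P.brC y x := by
  refine Prod.ext ?_ ?_
  · change P.br x.1 y.1 - P.br x.2 y.2 = -(P.br y.1 x.1 - P.br y.2 x.2)
    rw [hL.br_skew x.1, hL.br_skew x.2]
    abel
  · change P.br x.1 y.2 + P.br x.2 y.1 = -(P.br y.1 x.2 + P.br y.2 x.1)
    rw [hL.br_skew x.1, hL.br_skew x.2]
    abel

theorem brC_add_right (x y z : Cx V) : P.brC x (y + z) = P.brC x y + P.brC x z := by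
  rw [hL.brC_skew, hL.brC_add, hL.brC_skew y, hL.brC_skew z]
  abel

theorem brC_smul_right (c : ℂ) (x y : Cx V) : P.brC x (c • y) = c • P.brC x y := by
  rw [hL.brC_skew, hL.brC_smul, hL.brC_skew y, smul_neg, neg_neg]

theorem jacobiC (x y z : Cx V) :
    P.brC (P.brC x y) z = P.brC x (P.brC y z) - P.brC y (P.brC x z) := by
  refine Prod.ext ?_ ?_
  · change P.br (P.br x.1 y.1 - P.br x.2 y.2) z.1 - P.br (P.br x.1 y.2 + P.br x.2 y.1) z.2
      = P.br x.1 (P.br y.1 z.1 - P.br y.2 z.2) - P.br x.2 (P.br y.1 z.2 + P.br y.2 z.1)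
        - (P.br y.1 (P.br x.1 z.1 - P.br x.2 z.2) - P.br y.2 (P.br x.1 z.2 + P.br x.2 z.1))
    simp only [hL.br_sub, hL.br_add, hL.br_sub_right, hL.br_add_right, hL.jacobi]
    abel
  · change P.br (P.br x.1 y.1 - P.br x.2 y.2) z.2 + P.br (P.br x.1 y.2 + P.br x.2 y.1) z.1
      = P.br x.1 (P.br y.1 z.2 + P.br y.2 z.1) + P.br x.2 (P.br y.1 z.1 - P.br y.2 z.2)
        - (P.br y.1 (P.br x.1 z.2 + P.br x.2 z.1) + P.br y.2 (P.br x.1 z.1 - P.br x.2 z.2))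
    simp only [hL.br_sub, hL.br_add, hL.br_sub_right, hL.br_add_right, hL.jacobi]
    abel

theorem ipC_add (x y z : Cx V) : P.ipC (x + y) z = P.ipC x z + P.ipC y z := by
  simp only [ipC, Cx.add_fst, Cx.add_snd, hL.ip_add]
  push_cast
  ring

theorem ipC_add_right (x y z : Cx V) : P.ipC x (y + z) = P.ipC x y + P.ipC x z := by
  simp only [ipC, Cx.add_fst, Cx.add_snd, hL.ip_add_right]
  push_cast
  ring

theorem ipC_smul (c : ℂ) (x y : Cx V) : P.ipC (c • x) y = c * P.ipC x y := by
  conv_rhs => rw [← Complex.re_add_im c]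
  simp only [ipC, Cx.smul_fst, Cx.smul_snd, hL.ip_add, hL.ip_sub, hL.ip_smul]
  push_cast
  linear_combination -(c.im : ℂ) * ((P.ip x.2 y.1 : ℂ) - (P.ip x.1 y.2 : ℂ)) * Complex.I_sq

theorem ipC_smul_right (c : ℂ) (x y : Cx V) : P.ipC x (c • y) = conj c * P.ipC x y := by
  conv_rhs => rw [← Complex.re_add_im c]
  simp only [ipC, Cx.smul_fst, Cx.smul_snd, hL.ip_add_right, hL.ip_sub_right, hL.ip_smul_right,
    map_add, map_mul, Complex.conj_ofReal, Complex.conj_I]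
  push_cast
  linear_combination (c.im : ℂ) * ((P.ip x.2 y.1 : ℂ) - (P.ip x.1 y.2 : ℂ)) * Complex.I_sq

theorem ipC_zero (y : Cx V) : P.ipC 0 y = 0 := by
  simpa using hL.ipC_smul 0 0 y

theorem ipC_zero_right (x : Cx V) : P.ipC x 0 = 0 := by
  simpa using hL.ipC_smul_right 0 x 0

theorem ipC_neg_right (x y : Cx V) : P.ipC x (-y) = -P.ipC x y := by
  simpa using hL.ipC_smul_right (-1) x y

theorem ipC_sub_right (x y z : Cx V) : P.ipC x (y - z) = P.ipC x y - P.ipC x z := by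
  rw [sub_eq_add_neg, hL.ipC_add_right, hL.ipC_neg_right, sub_eq_add_neg]

theorem ipC_sum_right {κ : Type*} (s : Finset κ) (x : Cx V) (y : κ → Cx V) :
    P.ipC x (∑ i ∈ s, y i) = ∑ i ∈ s, P.ipC x (y i) := by
  classical
  induction s using Finset.induction_on with
  | empty => simp [hL.ipC_zero_right]
  | insert i s hi ih => rw [Finset.sum_insert hi, Finset.sum_insert hi, hL.ipC_add_right, ih]

/-- Invariance of the real form; `x` is conjugated because it passes into the conjugate linear slot.
-/
theorem ipC_brC (x u w : Cx V) : P.ipC (P.brC x u) w = -P.ipC u (P.brC x.conj w) := by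
  simp only [ipC, brC, Cx.conj, hL.ip_sub, hL.ip_add, hL.ip_sub_right, hL.ip_add_right,
    hL.br_neg, hL.ip_neg_right, hL.ip_invariant]
  push_cast
  ring

theorem ipC_nondeg {y : Cx V} (h : ∀ x, P.ipC x y = 0) : y = 0 := by
  have h1 : ∀ x, P.ip x y.1 = 0 ∧ P.ip x y.2 = 0 := by
    intro x
    -- Real test vectors suffice: the real and imaginary parts of the pairing then isolate the two
    -- components of `y`.
    have := h (Cx.ofReal x)
    have h0 : ∀ y, P.ip 0 y = 0 := fun y => by simpa using hL.ip_smul 0 0 y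
    simp only [ipC, Cx.ofReal, h0, add_zero, zero_sub] at this
    have hr := congrArg Complex.re this
    have hi := congrArg Complex.im this
    simp at hr hi
    exact ⟨hr, hi⟩
  exact Prod.ext (hL.ip_nondeg _ fun x => (h1 x).1) (hL.ip_nondeg _ fun x => (h1 x).2)

theorem real_smul_brC (r : ℝ) (x y : Cx V) : P.brC (r • x) y = r • P.brC x y := by
  rw [Cx.real_smul, Cx.real_smul, hL.brC_smul]

omit hL in
/-- The bracket of `V ⊗ ℂ` as a real bilinear map. -/
def brBilin (hL : P.IsLieData) : Cx V →ₗ[ℝ] Cx V →ₗ[ℝ] Cx V :=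
  LinearMap.mk₂ ℝ P.brC hL.brC_add hL.real_smul_brC hL.brC_add_right
    (fun r x y => by rw [Cx.real_smul, Cx.real_smul, hL.brC_smul_right])

omit hL in
/-- The hermitian form of `V ⊗ ℂ` as a real bilinear map. -/
def ipBilin (hL : P.IsLieData) : Cx V →ₗ[ℝ] Cx V →ₗ[ℝ] ℂ :=
  LinearMap.mk₂ ℝ P.ipC hL.ipC_add
    (fun r x y => by rw [Cx.real_smul, hL.ipC_smul, Complex.real_smul])
    hL.ipC_add_right
    (fun r x y => by rw [Cx.real_smul, hL.ipC_smul_right, Complex.conj_ofReal, Complex.real_smul])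

variable [FiniteDimensional ℝ V]

theorem pd_brC (a : Idx) {f g : C2 → Cx V} {z : C2} (hf : DifferentiableAt ℝ f z)
    (hg : DifferentiableAt ℝ g z) : pd a (fun w => P.brC (f w) (g w)) z
      = P.brC (pd a f z) (g z) + P.brC (f z) (pd a g z) :=
  pd_bilin hL.brBilin hL.brC_smul hL.brC_smul_right a hf hg

theorem pd_ipC (a : Idx) {f g : C2 → Cx V} {z : C2} (hf : DifferentiableAt ℝ f z)
    (hg : DifferentiableAt ℝ g z) : pd a (fun w => P.ipC (f w) (g w)) z
      = P.ipC (pd a f z) (g z) + P.ipC (f z) (pd (bar a) g z) :=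
  pd_sesq hL.ipBilin hL.ipC_smul hL.ipC_smul_right a hf hg

theorem smooth_brC {D : Set C2} {f g : C2 → Cx V} (hf : ContDiffOn ℝ ∞ f D)
    (hg : ContDiffOn ℝ ∞ g D) : ContDiffOn ℝ ∞ (fun w => P.brC (f w) (g w)) D :=
  contDiffOn_bilin hL.brBilin hf hg

theorem smooth_ipC {D : Set C2} {f g : C2 → Cx V} (hf : ContDiffOn ℝ ∞ f D)
    (hg : ContDiffOn ℝ ∞ g D) : ContDiffOn ℝ ∞ (fun w => P.ipC (f w) (g w)) D :=
  contDiffOn_bilin hL.ipBilin hf hg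

end IsLieData

/-- The covariant derivative `∂_a u + [A_a, u]` of a section of the adjoint bundle. -/
def covD (P : Patch V) (a : Idx) (u : C2 → Cx V) (z : C2) : Cx V :=
  pd a u z + P.brC (P.conn z a) (u z)

/-- The patch carries a smooth Kähler metric, a smooth connection, and a Lie algebra with a
nondegenerate invariant form. -/
structure IsRegular (P : Patch V) : Prop extends P.IsKahlerMetric, P.IsLieData where
  smooth_A : ∀ v, ContDiffOn ℝ ∞ (fun z => P.A z v) P.D

/-- The connection form is real. -/
theorem conn_bar (z : C2) (a : Idx) : P.conn z (bar a) = (P.conn z a).conj := by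
  rw [conn, conn, cpt_eq, cpt_eq, base_bar, frameSign_bar]
  refine Prod.ext ?_ ?_ <;> cases a <;>
    simp [Cx.conj, Cx.smul_fst, Cx.smul_snd, Cx.add_fst, Cx.add_snd, Cx.ofReal_fst,
      Cx.ofReal_snd, Cx.neg_fst, Cx.neg_snd, frameSign]

namespace IsRegular

variable (hR : P.IsRegular)
include hR

theorem smooth_conn (a : Idx) : ContDiffOn ℝ ∞ (fun z => P.conn z a) P.D :=
  contDiffOn_cpt (fun v => contDiffOn_ofRealCx (hR.smooth_A v)) a

variable [FiniteDimensional ℝ V]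

theorem smooth_covD (a : Idx) {u : C2 → Cx V} (hu : ContDiffOn ℝ ∞ u P.D) :
    ContDiffOn ℝ ∞ (P.covD a u) P.D :=
  (contDiffOn_pd hR.isOpen hu a).add (hR.smooth_brC (hR.smooth_conn a) hu)

omit [FiniteDimensional ℝ V] in
theorem covD_congr {u v : C2 → Cx V} (h : ∀ z ∈ P.D, u z = v z) {z : C2} (hz : z ∈ P.D) (a : Idx) :
    P.covD a u z = P.covD a v z := by
  rw [covD, covD, pd_congr_on hR.isOpen h hz, h z hz]

omit [FiniteDimensional ℝ V] in
theorem covD_sub (a : Idx) {u v : C2 → Cx V} {z : C2} (hu : DifferentiableAt ℝ u z)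
    (hv : DifferentiableAt ℝ v z) :
    P.covD a (fun w => u w - v w) z = P.covD a u z - P.covD a v z := by
  have h : P.brC (P.conn z a) (u z - v z)
      = P.brC (P.conn z a) (u z) - P.brC (P.conn z a) (v z) := map_sub (hR.brBilin _) _ _
  rw [covD, covD, covD, pd_sub a hu hv, h]
  abel

theorem covD_smul (a : Idx) {c : C2 → ℂ} {u : C2 → Cx V} {z : C2} (hc : DifferentiableAt ℝ c z)
    (hu : DifferentiableAt ℝ u z) :
    P.covD a (fun w => c w • u w) z = pd a c z • u z + c z • P.covD a u z := by
  rw [covD, covD, pd_smul a hc hu, hR.brC_smul_right, smul_add, add_assoc]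

theorem covD_const_smul (a : Idx) (c : ℂ) {u : C2 → Cx V} {z : C2}
    (hu : DifferentiableAt ℝ u z) :
    P.covD a (fun w => c • u w) z = c • P.covD a u z := by
  rw [hR.covD_smul a (differentiableAt_const c) hu]
  simp

/-- The curvature is the commutator of the covariant derivatives. -/
theorem covD_comm {u : C2 → Cx V} (hu : ContDiffOn ℝ ∞ u P.D) {z : C2} (hz : z ∈ P.D)
    (a b : Idx) :
    P.covD a (P.covD b u) z - P.covD b (P.covD a u) z = P.brC (P.curv z a b) (u z) := by
  have du : DifferentiableAt ℝ u z := differentiableAt_of_isOpen hR.isOpen hu hz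
  have dpu : ∀ a, DifferentiableAt ℝ (pd a u) z := fun a =>
    differentiableAt_of_isOpen hR.isOpen (contDiffOn_pd hR.isOpen hu a) hz
  have dc : ∀ a, DifferentiableAt ℝ (fun z => P.conn z a) z := fun a =>
    differentiableAt_of_isOpen hR.isOpen (hR.smooth_conn a) hz
  have dbr : ∀ a, DifferentiableAt ℝ (fun z => P.brC (P.conn z a) (u z)) z := fun a =>
    differentiableAt_of_isOpen hR.isOpen (hR.smooth_brC (hR.smooth_conn a) hu) hz
  have e : ∀ a b, P.covD a (P.covD b u) z = pd a (pd b u) z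
      + (P.brC (pd a (fun z => P.conn z b) z) (u z) + P.brC (P.conn z b) (pd a u z))
      + (P.brC (P.conn z a) (pd b u z) + P.brC (P.conn z a) (P.brC (P.conn z b) (u z))) := by
    intro a b
    rw [← hR.pd_brC a (dc b) du, ← hR.brC_add_right, ← pd_add a (dpu b) (dbr b)]
    rfl
  have hsub : ∀ x y w : Cx V, P.brC (x - y) w = P.brC x w - P.brC y w := fun x y w =>
    (congrArg (fun L => L w) (map_sub hR.brBilin x y))
  rw [e, e, curv, hR.brC_add, hsub, hR.jacobiC, pd_pd_comm hR.isOpen hu hz a b]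
  abel

omit [FiniteDimensional ℝ V] in
theorem curv_skew (z : C2) (a b : Idx) : P.curv z a b = -P.curv z b a := by
  rw [curv, curv, hR.brC_skew]
  abel

/-- The connection is unitary: the two bracket terms cancel by `ipC_brC`, since the components of
`A` at `a` and `ā` are conjugate. -/
theorem pd_ipC_cov (a : Idx) {u v : C2 → Cx V} {z : C2} (hu : DifferentiableAt ℝ u z)
    (hv : DifferentiableAt ℝ v z) : pd a (fun w => P.ipC (u w) (v w)) z
      = P.ipC (P.covD a u z) (v z) + P.ipC (u z) (P.covD (bar a) v z) := by
  rw [hR.pd_ipC a hu hv, covD, covD, hR.ipC_add, hR.ipC_add_right, conn_bar, hR.ipC_brC]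
  ring

omit [FiniteDimensional ℝ V] in
-- Raising both indices of `ω` gives `-frameSign b * g^{ab}`. The two mixed blocks then contribute
-- equally, by skewness of the curvature, and absorb the factor `1/2`.
theorem fHat_eq {z : C2} (hz : z ∈ P.D) : P.fHat z = (Complex.I * (P.hermDet z)⁻¹) •
    ∑ ν, ∑ μ, P.cof ν μ z • P.curv z (Sum.inr ν) (Sum.inl μ) := by
  have hK := hR.toIsKahlerMetric
  have h1 : ∀ b c, ∑ d, P.gUp z b d * P.omega z c d
      = -frameSign c * (1 : Matrix Idx Idx ℂ) b c := by
    intro b c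
    have hdet : Matrix.of (P.gUp z) * Matrix.of (P.gLow z) = 1 := by
      have hu := hK.gUp_eq hz
      have h0 := hK.hermDet_ne hz
      rw [hu]
      ext a b
      rw [Matrix.mul_apply]
      simp only [Fintype.sum_sum_type, Fin.sum_univ_two, Matrix.of_apply]
      rcases a with μ | μ <;> rcases b with ν | ν <;> fin_cases μ <;> fin_cases ν <;>
        simp [hK.gLow_inl_inl hz, hK.gLow_inr_inr hz, hK.gLow_inr_inl hz,
          IsKahlerMetric.gLow_inl_inr, cof] <;>
        field_simp <;> rw [hermDet] <;> ring
    rw [← hdet, Matrix.mul_apply, Finset.mul_sum]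
    refine Finset.sum_congr rfl fun d _ => ?_
    rw [hK.omega_eq hz, hK.gLow_symm hz]
    simp only [Matrix.of_apply]
    ring
  have h2 : ∀ a b, ∑ c, ∑ d, (P.gUp z a c * P.gUp z b d * P.omega z c d) • P.curv z a b
      = (-frameSign b * P.gUp z a b) • P.curv z a b := by
    intro a b
    simp only [← Finset.sum_smul, mul_assoc, ← Finset.mul_sum, h1]
    congr 1
    rw [Finset.sum_eq_single b]
    · simp; ring
    · intro c _ hc
      simp [Matrix.one_apply_ne hc.symm]
    · simp
  rw [fHat]
  simp only [h2]
  simp only [Fintype.sum_sum_type, hK.gUp_inl_inl hz, hK.gUp_inr_inr hz, hK.gUp_inl_inr hz,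
    hK.gUp_inr_inl hz, mul_zero, zero_smul, zero_add, add_zero, Fin.sum_univ_two,
    frameSign, Sum.elim_inl, Sum.elim_inr]
  rw [hR.curv_skew z (Sum.inl 0) (Sum.inr 0), hR.curv_skew z (Sum.inl 0) (Sum.inr 1),
    hR.curv_skew z (Sum.inl 1) (Sum.inr 0), hR.curv_skew z (Sum.inl 1) (Sum.inr 1)]
  module

end IsRegular

end Patch

/-! ### Forms of type `(0,1)` and `(0,2)` in components. -/

/-- The components of `dz̄^0 ∧ dz̄^1`. -/
def eps₂ : Idx → Idx → ℂ
  | Sum.inr i, Sum.inr j => !![0, 1; -1, 0] i j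
  | _, _ => 0

/-- The components of `dz̄^0 ∧ dz̄^1`, as a function of multi-indices. -/
def eps (a : Fin 2 → Idx) : ℂ := eps₂ (a 0) (a 1)

/-- The multi-index `0̄ 1̄`. -/
def topIdx : Fin 2 → Idx := ![Sum.inr 0, Sum.inr 1]

@[simp] theorem eps₂_inl (μ : Fin 2) (b : Idx) : eps₂ (Sum.inl μ) b = 0 := rfl

@[simp] theorem eps₂_inr_inl (i μ : Fin 2) : eps₂ (Sum.inr i) (Sum.inl μ) = 0 := rfl

@[simp] theorem eps₂_inr_inr (i j : Fin 2) :
    eps₂ (Sum.inr i) (Sum.inr j) = !![0, 1; -1, 0] i j := rfl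

@[simp] theorem eps_topIdx : eps topIdx = 1 := by simp [eps, topIdx]

theorem eq_vec_two (a : Fin 2 → Idx) : a = ![a 0, a 1] := by
  funext i
  fin_cases i <;> rfl

namespace Patch

variable {V : Type*} [NormedAddCommGroup V] [NormedSpace ℝ V] {P : Patch V}

/-- Type kills unbarred indices and alternation kills repeated ones. This reduces the whole problem
to one section of the adjoint bundle. -/
theorem IsForm.eq_eps {D : Set C2} {T : Tens V 2} (hT : IsForm D T) {z : C2} (hz : z ∈ D)
    (a : Fin 2 → Idx) : T z a = eps a • T z topIdx := by
  have hswap : ∀ a, T z (a ∘ Equiv.swap 0 1) = -T z a := by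
    intro a
    rw [hT.alternating z hz]
    simp [Units.smul_def]
  obtain ⟨x, y, rfl⟩ : ∃ x y, a = ![x, y] := ⟨_, _, eq_vec_two a⟩
  have hs : ∀ x y, T z ![y, x] = -T z ![x, y] := by
    intro x y
    rw [← hswap]
    congr 1
    funext i
    fin_cases i <;> rfl
  have hself : ∀ x, T z ![x, x] = 0 := by
    intro x
    have h := hs x x
    have h2 : (2 : ℂ) • T z ![x, x] = 0 := by
      rw [two_smul]
      nth_rewrite 1 [h]
      exact neg_add_cancel _
    simpa using h2
  rcases x with μ | i
  · rw [hT.type z hz _ fun h => by simpa using h 0]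
    simp [eps]
  rcases y with μ | j
  · rw [hT.type z hz _ fun h => by simpa using h 1]
    simp [eps]
  fin_cases i <;> fin_cases j
  · rw [hself]; simp [eps]
  · simp [eps, topIdx]
  · simpa [eps, topIdx] using hs (Sum.inr 0) (Sum.inr 1)
  · rw [hself]; simp [eps]

theorem isForm_eps {D : Set C2} {u : C2 → Cx V} (hu : ContDiffOn ℝ ∞ u D) :
    IsForm D (fun z (a : Fin 2 → Idx) => eps a • u z : Tens V 2) where
  smooth a := hu.const_smul (eps a)
  alternating z _ σ a := by
    rw [← smul_assoc]
    congr 1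
    obtain ⟨x, y, rfl⟩ : ∃ x y, a = ![x, y] := ⟨_, _, eq_vec_two a⟩
    have hσ : σ = 1 ∨ σ = Equiv.swap 0 1 := by
      revert σ
      decide
    rcases hσ with rfl | rfl
    · simp
    · simp only [ne_eq, Fin.zero_ne_one, not_false_eq_true, Equiv.Perm.sign_swap, eps,
        Function.comp_apply, Equiv.swap_apply_left, Equiv.swap_apply_right, Matrix.cons_val_zero,
        Matrix.cons_val_one, Units.smul_def, Units.val_neg, Units.val_one, neg_smul, one_smul]
      rcases x with μ | i
      · rcases y <;> simp
      rcases y with μ | j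
      · simp
      fin_cases i <;> fin_cases j <;> simp
  type z _ a ha := by
    obtain ⟨x, y, rfl⟩ : ∃ x y, a = ![x, y] := ⟨_, _, eq_vec_two a⟩
    rcases x with μ | i
    · simp [eps]
    rcases y with μ | j
    · simp [eps]
    exact absurd (fun k => by fin_cases k <;> rfl) ha

/-- The `(0,1)`-form with components `x ν`. -/
def oneForm (x : Fin 2 → C2 → Cx V) : Tens V 1 := fun z a =>
  Sum.elim (fun _ => 0) (fun ν => x ν z) (a 0)

theorem isForm_oneForm {D : Set C2} {x : Fin 2 → C2 → Cx V} (hx : ∀ ν, ContDiffOn ℝ ∞ (x ν) D) :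
    IsForm D (oneForm x) where
  smooth a := by
    unfold oneForm
    rcases a 0 with μ | ν
    · exact contDiffOn_const
    · exact hx ν
  alternating z _ σ a := by
    rw [Subsingleton.elim σ 1]
    simp
  type z _ a ha := by
    unfold oneForm
    rcases h : a 0 with μ | ν
    · rfl
    · exact absurd (fun j => by rw [Subsingleton.elim j 0, h]; rfl) ha

/-! ### Inner products -/

theorem tensIP_zero (z : C2) (S T : (Fin 0 → Idx) → Cx V) :
    P.tensIP z S T = P.ipC (S ![]) (T ![]) := by
  simp only [tensIP, Fintype.sum_unique, Finset.univ_eq_empty, Finset.prod_empty, one_mul]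
  congr 2 <;> exact Subsingleton.elim _ _

/-- Splitting off the first index turns sums over multi-indices into iterated sums over `Idx`, where
the block form of `g^{ab}` can be used. -/
theorem tensIP_succ {k : ℕ} (z : C2) (S T : (Fin (k + 1) → Idx) → Cx V) :
    P.tensIP z S T = ∑ c, ∑ d, P.gUp z c d *
      P.tensIP z (fun t => S (Matrix.vecCons c t)) (fun t => T (Matrix.vecCons (bar d) t)) := by
  have e : ∀ f : (Fin (k + 1) → Idx) → ℂ,
      ∑ a, f a = ∑ c : Idx, ∑ t : Fin k → Idx, f (Matrix.vecCons c t) := by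
    intro f
    rw [← (Fin.consEquiv fun _ => Idx).sum_comp, Fintype.sum_prod_type]
    rfl
  simp only [tensIP, e, Finset.mul_sum]
  refine Finset.sum_congr rfl fun c _ => ?_
  rw [Finset.sum_comm]
  refine Finset.sum_congr rfl fun d _ => Finset.sum_congr rfl fun t _ =>
    Finset.sum_congr rfl fun t' _ => ?_
  rw [Fin.prod_univ_succ, mul_assoc]
  have hb : (fun j => bar (Matrix.vecCons d t' j)) = Matrix.vecCons (bar d) fun j => bar (t' j) := by
    funext j
    refine Fin.cases rfl (fun j => rfl) j
  rw [hb]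
  rfl

section

variable (hR : P.IsRegular) {z : C2} (hz : z ∈ P.D)
include hR hz

theorem tensIP_oneForm (x y : Fin 2 → C2 → Cx V) :
    P.tensIP z (oneForm x z) (oneForm y z)
      = ∑ ν, ∑ μ, (P.hermDet z)⁻¹ * P.cof ν μ z * P.ipC (x ν z) (y μ z) := by
  rw [tensIP_succ]
  simp only [tensIP_zero, Fintype.sum_sum_type, oneForm, Matrix.cons_val_zero, Sum.elim_inl,
    Sum.elim_inr, hR.ipC_zero, hR.ipC_zero_right, bar, Sum.swap_inl, Sum.swap_inr,
    hR.gUp_inr_inl hz, mul_zero, Finset.sum_const_zero, zero_add, add_zero]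

/-- The sum is `2 det(h⁻¹)`; the `2` counts the orderings of `0̄ 1̄`, as this is the tensor norm and
not the form norm. -/
theorem tensIP_eps (x y : Cx V) :
    P.tensIP z (fun a => eps a • x) (fun a => eps a • y) = 2 * (P.hermDet z)⁻¹ * P.ipC x y := by
  have h0 := hR.hermDet_ne hz
  rw [tensIP_succ]
  simp only [tensIP_succ, tensIP_zero, Fintype.sum_sum_type, eps, Matrix.cons_val_zero,
    Matrix.cons_val_one, hR.ipC_smul, hR.ipC_smul_right, bar, Sum.swap_inl, Sum.swap_inr,
    eps₂_inl, eps₂_inr_inl, eps₂_inr_inr, hR.gUp_inr_inl hz, mul_zero, Finset.sum_const_zero,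
    zero_add, add_zero, map_zero, zero_mul, Fin.sum_univ_two]
  simp [cof]
  field_simp
  rw [hermDet]
  ring

theorem tensIP_eps_succ (x y : Idx → Cx V) :
    P.tensIP z (fun a : Fin 3 → Idx => eps (Fin.tail a) • x (a 0))
      (fun a : Fin 3 → Idx => eps (Fin.tail a) • y (a 0))
      = 2 * (P.hermDet z)⁻¹ * ∑ ν, ∑ μ, (P.hermDet z)⁻¹ * P.cof ν μ z *
        (P.ipC (x (Sum.inr ν)) (y (Sum.inr μ)) + P.ipC (x (Sum.inl μ)) (y (Sum.inl ν))) := by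
  rw [tensIP_succ]
  have ht : ∀ (c : Idx) (t : Fin 2 → Idx), Fin.tail (Matrix.vecCons c t : Fin 3 → Idx) = t :=
    fun c t => rfl
  simp only [ht, Matrix.cons_val_zero, tensIP_eps hR hz, Fintype.sum_sum_type,
    hR.gUp_inl_inl hz, hR.gUp_inr_inr hz, hR.gUp_inl_inr hz, hR.gUp_inr_inl hz, bar, Sum.swap_inl,
    Sum.swap_inr, zero_mul, zero_add, add_zero, Fin.sum_univ_two]
  ring

end

/-! ### Derivatives of forms -/

/-- The connection coefficients of the bundle of `(0,2)`-forms. -/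
def gamIdx (P : Patch V) (a : Idx) (z : C2) : ℂ := Sum.elim (fun _ => 0) (fun ν => P.gam ν z) a

/-- The covariant derivative on `(0,2)`-forms, in terms of the component `0̄ 1̄`. -/
def covK (P : Patch V) (a : Idx) (u : C2 → Cx V) (z : C2) : Cx V :=
  P.covD a u z - P.gamIdx a z • u z

theorem dbar_one (T : Tens V 1) (z : C2) (a : Fin 2 → Idx) : P.dbar T z a
    = eps a • (P.covD (Sum.inr 0) (fun w => T w ![Sum.inr 1]) z
      - P.covD (Sum.inr 1) (fun w => T w ![Sum.inr 0]) z) := by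
  obtain ⟨x, y, rfl⟩ : ∃ x y, a = ![x, y] := ⟨_, _, eq_vec_two a⟩
  have e0 : (0 : Fin 2).removeNth ![x, y] = ![y] := by
    funext i
    fin_cases i
    rfl
  have e1 : (1 : Fin 2).removeNth ![x, y] = ![x] := by
    funext i
    fin_cases i
    rfl
  have h : P.extCov T z ![x, y]
      = P.covD x (fun w => T w ![y]) z - P.covD y (fun w => T w ![x]) z := by
    rw [extCov, Fin.sum_univ_two, e0, e1]
    simp only [covD, Fin.val_zero, Fin.val_one, pow_zero, pow_one, one_smul, neg_smul,
      Matrix.cons_val_zero, Matrix.cons_val_one]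
    abel
  simp only [dbar, h, eps, Matrix.cons_val_zero, Matrix.cons_val_one]
  rcases x with μ | i
  · simp
  rcases y with μ | j
  · simp
  fin_cases i <;> fin_cases j <;> simp

section

variable [FiniteDimensional ℝ V] (hR : P.IsRegular) {T : Tens V 2} (hT : IsForm P.D T)
include hR hT

theorem IsForm.covD_eq {z : C2} (hz : z ∈ P.D) (c : Idx) (a : Fin 2 → Idx) :
    P.covD c (fun w => T w a) z = eps a • P.covD c (fun w => T w topIdx) z := by
  rw [hR.covD_congr (fun w hw => hT.eq_eps hw a) hz,
    hR.covD_const_smul _ _ (differentiableAt_of_isOpen hR.isOpen (hT.smooth topIdx) hz)]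

/-- Three barred indices take only two values, so two coincide; the corresponding two terms cancel
and the third vanishes. -/
theorem IsForm.dbar_eq_zero {z : C2} (hz : z ∈ P.D) (a : Fin 3 → Idx) : P.dbar T z a = 0 := by
  have h : P.extCov T z a = ∑ j : Fin 3, (-1 : ℂ) ^ (j : ℕ) •
      eps (j.removeNth a) • P.covD (a j) (fun w => T w topIdx) z := by
    refine Finset.sum_congr rfl fun j _ => ?_
    rw [← hT.covD_eq hR hz]
    rfl
  have e0 : eps ((0 : Fin 3).removeNth a) = eps₂ (a 1) (a 2) := rfl
  have e1 : eps ((1 : Fin 3).removeNth a) = eps₂ (a 0) (a 2) := rfl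
  have e2 : eps ((2 : Fin 3).removeNth a) = eps₂ (a 0) (a 1) := rfl
  rw [dbar]
  split_ifs with ha
  · rw [h, Fin.sum_univ_three, e0, e1, e2]
    have hbar : ∀ j, ∃ i, a j = Sum.inr i := by
      intro j
      rcases h : a j with μ | i
      · have := ha j
        simp [h] at this
      · exact ⟨i, rfl⟩
    obtain ⟨i, hi⟩ := hbar 0
    obtain ⟨j, hj⟩ := hbar 1
    obtain ⟨k, hk⟩ := hbar 2
    rw [hi, hj, hk]
    fin_cases i <;> fin_cases j <;> fin_cases k <;> simp
  · rfl

omit [FiniteDimensional ℝ V] hT in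
-- An endomorphism acts on the top exterior power as a derivation by its trace, which `sum_Gam_inr`
-- evaluates.
theorem sum_Gam_eps {z : C2} (hz : z ∈ P.D) (x : Idx) (b : Fin 2 → Idx) :
    ∑ j, ∑ c, P.Gam z c x (b j) * eps (Function.update b j c) = P.gamIdx x z * eps b := by
  obtain ⟨p, q, rfl⟩ : ∃ x y, b = ![x, y] := ⟨_, _, eq_vec_two b⟩
  have hK := hR.toIsKahlerMetric
  rw [Fin.sum_univ_two]
  simp only [Matrix.cons_val_zero, Matrix.cons_val_one, Fintype.sum_sum_type, eps]
  rcases x with α | τ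
  · rcases p with μ | i
    · simp [hK.Gam_inr_inl_left hz, gamIdx]
    rcases q with μ | j
    · simp [hK.Gam_inr_inl_left hz, gamIdx]
    simp [hK.Gam_inr_inl_left hz, gamIdx]
  · have ht := hK.sum_Gam_inr hz τ
    rw [Fin.sum_univ_two] at ht
    rcases p with μ | i
    · simp [hK.Gam_inr_inl hz]
    rcases q with μ | j
    · simp [hK.Gam_inr_inl hz]
    simp only [gamIdx, Sum.elim_inr, ← ht]
    fin_cases i <;> fin_cases j <;> simp [Fin.sum_univ_two]

theorem IsForm.nabla_eq {z : C2} (hz : z ∈ P.D) (a : Fin 3 → Idx) : P.nabla T z a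
    = eps (Fin.tail a) • P.covK (a 0) (fun w => T w topIdx) z := by
  have h1 : P.nabla T z a = P.covD (a 0) (fun w => T w (Fin.tail a)) z
      - ∑ j : Fin 2, ∑ c : Idx, P.Gam z c (a 0) (Fin.tail a j)
        • T z (Function.update (Fin.tail a) j c) := rfl
  rw [h1, hT.covD_eq hR hz, covK, smul_sub]
  congr 1
  have h2 : ∀ j c, P.Gam z c (a 0) (Fin.tail a j) • T z (Function.update (Fin.tail a) j c)
      = (P.Gam z c (a 0) (Fin.tail a j) * eps (Function.update (Fin.tail a) j c))
        • T z topIdx := by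
    intro j c
    rw [hT.eq_eps hz, mul_smul]
  simp only [h2, ← Finset.sum_smul, sum_Gam_eps hR hz]
  rw [← mul_smul, mul_comm]

end

end Patch

/-! ### Integration by parts and the fundamental lemma -/

section Integration

theorem tsupport_subset_of_eq_zero {W : Type*} [Zero W] {f : C2 → W} {K : Set C2}
    (hK : IsClosed K) (h : ∀ z, z ∉ K → f z = 0) : tsupport f ⊆ K :=
  closure_minimal (fun z hz => by_contra fun hn => (Function.mem_support.1 hz) (h z hn)) hK

variable {D K : Set C2}

theorem integrableOn_of_eq_zero (hD : IsOpen D) (hK : IsCompact K) (hKD : K ⊆ D) {F : C2 → ℂ}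
    (hF : ContinuousOn F D) (h0 : ∀ z ∈ D, z ∉ K → F z = 0) : IntegrableOn F D :=
  ((hF.mono hKD).integrableOn_compact hK).of_forall_sdiff_eq_zero hD.measurableSet
    fun z hz => h0 z hz.1 hz.2

theorem integral_fderiv_eq_zero {Y : C2 → ℂ} (hY : ContDiff ℝ ∞ Y) (hc : HasCompactSupport Y)
    (v : C2) : ∫ z, fderiv ℝ Y z v = 0 := by
  have hc' : Continuous fun z => fderiv ℝ Y z v := (hY.continuous_fderiv (by simp)).clm_apply
    continuous_const
  -- Integration by parts against the constant function `1`.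
  have h := integral_mul_fderiv_eq_neg_fderiv_mul_of_integrable (μ := (volume : Measure C2))
    (f := fun _ => (1 : ℂ)) (g := Y) (v := v) (by simp)
    (by simpa using hc'.integrable_of_hasCompactSupport (hc.fderiv_apply (𝕜 := ℝ) v))
    (by simpa using hY.continuous.integrable_of_hasCompactSupport hc)
    (fun _ _ => differentiableAt_const _)
    (fun z _ => (hY.differentiable (by simp)).differentiableAt)
  simpa using h

theorem pd_eq_zero_off (hD : IsOpen D) (hK : IsCompact K) {X : C2 → ℂ}
    (h0 : ∀ z ∈ D, z ∉ K → X z = 0) (a : Idx) {z : C2} (hz : z ∈ D) (hzK : z ∉ K) :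
    pd a X z = 0 := by
  rw [pd_congr_on (hD.inter hK.isClosed.isOpen_compl) (g := fun _ => 0)
    (fun y hy => h0 y hy.1 hy.2) ⟨hz, hzK⟩, pd_const]

theorem integral_pd_eq_zero (hD : IsOpen D) (hK : IsCompact K) (hKD : K ⊆ D) {X : C2 → ℂ}
    (hX : ContDiffOn ℝ ∞ X D) (h0 : ∀ z ∈ D, z ∉ K → X z = 0) (a : Idx) :
    ∫ z in D, pd a X z = 0 := by
  classical
  -- `X` is controlled only on `D`. Its extension by zero is smooth everywhere, because `X` vanishes
  -- on `D` outside the compact set `K ⊆ D`.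
  set Y : C2 → ℂ := D.indicator X with hYdef
  have hYX : ∀ z ∈ D, Y z = X z := fun z hz => Set.indicator_of_mem hz X
  have hY0 : ∀ z, z ∉ K → Y z = 0 := by
    intro z hz
    by_cases hzD : z ∈ D
    · rw [hYX z hzD, h0 z hzD hz]
    · exact Set.indicator_of_notMem hzD X
  have hYs : ContDiff ℝ ∞ Y := by
    rw [contDiff_iff_contDiffAt]
    intro z
    by_cases hz : z ∈ K
    · exact (hX.contDiffAt (hD.mem_nhds (hKD hz))).congr_of_eventuallyEq
        (Filter.eventually_of_mem (hD.mem_nhds (hKD hz)) hYX)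
    · exact contDiffAt_const.congr_of_eventuallyEq
        (Filter.eventually_of_mem (hK.isClosed.isOpen_compl.mem_nhds hz) hY0)
  have hYc : HasCompactSupport Y := HasCompactSupport.intro hK hY0
  have hint : ∀ v, Integrable fun z => fderiv ℝ Y z v := fun v =>
    ((hYs.continuous_fderiv (by simp)).clm_apply continuous_const).integrable_of_hasCompactSupport
      (hYc.fderiv_apply (𝕜 := ℝ) v)
  have hpd0 : ∀ z, z ∉ D → pd a Y z = 0 := by
    intro z hz
    rw [pd_congr_on hK.isClosed.isOpen_compl (g := fun _ => 0) hY0 (fun h => hz (hKD h)), pd_const]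
  rw [setIntegral_congr_fun hD.measurableSet (g := fun z => pd a Y z)
    (fun z hz => (pd_congr_on hD hYX hz a).symm),
    setIntegral_eq_integral_of_forall_compl_eq_zero hpd0]
  simp only [pd_eq, smul_eq_mul]
  rw [integral_const_mul, integral_add (hint _) ((hint _).const_mul _), integral_const_mul,
    integral_fderiv_eq_zero hYs hYc, integral_fderiv_eq_zero hYs hYc]
  simp

/-- Two integrands that differ by a compactly supported divergence have the same integral. -/
theorem integral_eq_of_divergence (hD : IsOpen D) (hK : IsCompact K) (hKD : K ⊆ D)
    {F H : C2 → ℂ} {X : Idx → C2 → ℂ} (hX : ∀ a, ContDiffOn ℝ ∞ (X a) D)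
    (hX0 : ∀ a, ∀ z ∈ D, z ∉ K → X a z = 0) (hH : ContinuousOn H D)
    (hH0 : ∀ z ∈ D, z ∉ K → H z = 0) (h : ∀ z ∈ D, F z = H z + ∑ a, pd a (X a) z) :
    ∫ z in D, F z = ∫ z in D, H z := by
  have hi : ∀ a, IntegrableOn (pd a (X a)) D := fun a =>
    integrableOn_of_eq_zero hD hK hKD (contDiffOn_pd hD (hX a) a).continuousOn
      fun z hz hzK => pd_eq_zero_off hD hK (hX0 a) a hz hzK
  rw [setIntegral_congr_fun hD.measurableSet h,
    integral_add (integrableOn_of_eq_zero hD hK hKD hH hH0) (integrable_finsetSum _ fun a _ => hi a),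
    integral_finsetSum _ fun a _ => hi a,
    Finset.sum_eq_zero fun a _ => integral_pd_eq_zero hD hK hKD (hX a) (hX0 a) a, add_zero]

end Integration

namespace Patch

variable {V : Type*} [NormedAddCommGroup V] [NormedSpace ℝ V] [FiniteDimensional ℝ V]
  {P : Patch V}

namespace IsLieData

variable (hL : P.IsLieData) (hD : IsOpen P.D)
include hL hD

/-- The fundamental lemma of the calculus of variations, applied to the scalar function `⟨x, s⟩`
with test sections `ρ x`, followed by nondegeneracy of the form and continuity. -/
theorem eq_zero_of_integral {s : C2 → Cx V} (hs : ContDiffOn ℝ ∞ s P.D)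
    (h : ∀ b : C2 → Cx V, ContDiff ℝ ∞ b → HasCompactSupport b → tsupport b ⊆ P.D →
      ∫ z in P.D, P.ipC (b z) (s z) = 0) {z : C2} (hz : z ∈ P.D) : s z = 0 := by
  refine hL.ipC_nondeg fun x => ?_
  have hc : ContinuousOn (fun z => P.ipC x (s z)) P.D :=
    (hL.smooth_ipC contDiffOn_const hs).continuousOn
  have hae := hD.ae_eq_zero_of_integral_contDiff_smul_eq_zero (μ := (volume : Measure C2))
    (hc.locallyIntegrableOn hD.measurableSet) (by
      intro ρ hρ hρc hρD
      have hsub : tsupport (fun z => ρ z • x) ⊆ tsupport ρ :=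
        closure_mono (Function.support_smul_subset_left ρ _)
      have := h (fun z => ρ z • x) (hρ.smul contDiff_const) (hρc.smul_right) (hsub.trans hρD)
      rw [setIntegral_eq_integral_of_forall_compl_eq_zero] at this
      · rw [← this]
        refine integral_congr_ae (Filter.Eventually.of_forall fun z => ?_)
        simp only [Cx.real_smul, hL.ipC_smul, Complex.real_smul]
      · intro z hzD
        have : ρ z = 0 := image_eq_zero_of_notMem_tsupport fun hz => hzD (hρD hz)
        simp [this, hL.ipC_zero])
  have hae' : (fun z => P.ipC x (s z)) =ᵐ[volume.restrict P.D] fun _ => 0 :=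
    (ae_restrict_iff' hD.measurableSet).2 hae
  exact Measure.eqOn_open_of_ae_eq hae' hD hc continuousOn_const hz

theorem eq_of_integral {s t : C2 → Cx V} (hs : ContDiffOn ℝ ∞ s P.D) (ht : ContDiffOn ℝ ∞ t P.D)
    {c : ℂ} (hc : c ≠ 0)
    (h : ∀ b : C2 → Cx V, ContDiff ℝ ∞ b → HasCompactSupport b → tsupport b ⊆ P.D →
      ∫ z in P.D, c * P.ipC (b z) (s z) = ∫ z in P.D, c * P.ipC (b z) (t z)) {z : C2}
    (hz : z ∈ P.D) : s z = t z := by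
  refine sub_eq_zero.1 (hL.eq_zero_of_integral hD (s := fun z => s z - t z) (hs.sub ht) ?_ hz)
  intro b hb hbc hbD
  have hi : ∀ {s : C2 → Cx V}, ContDiffOn ℝ ∞ s P.D →
      IntegrableOn (fun z => P.ipC (b z) (s z)) P.D := fun hs =>
    integrableOn_of_eq_zero hD hbc hbD (hL.smooth_ipC hb.contDiffOn hs).continuousOn
      fun z _ hzb => by rw [image_eq_zero_of_notMem_tsupport hzb, hL.ipC_zero]
  have := h b hb hbc hbD
  rw [integral_const_mul, integral_const_mul] at this
  simp only [hL.ipC_sub_right]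
  rw [integral_sub (hi hs) (hi ht), mul_left_cancel₀ hc this, sub_self]

end IsLieData

/-! ### Uniqueness of formal adjoints -/

namespace IsRegular

variable (hR : P.IsRegular)
include hR

omit [FiniteDimensional ℝ V] in
theorem isTestForm_eps {b : C2 → Cx V} (hb : ContDiff ℝ ∞ b) (hbc : HasCompactSupport b)
    (hbD : tsupport b ⊆ P.D) :
    P.IsTestForm (fun z (a : Fin 2 → Idx) => eps a • b z : Tens V 2) := by
  have h : ∀ z, z ∉ tsupport b → (fun a : Fin 2 → Idx => eps a • b z) = 0 := by
    intro z hz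
    funext a
    rw [image_eq_zero_of_notMem_tsupport hz, smul_zero]
    rfl
  exact ⟨isForm_eps hb.contDiffOn, HasCompactSupport.intro hbc h,
    (tsupport_subset_of_eq_zero (isClosed_tsupport b) h).trans hbD⟩

omit [FiniteDimensional ℝ V] in
theorem isTestForm_oneForm {b : C2 → Cx V} (hb : ContDiff ℝ ∞ b) (hbc : HasCompactSupport b)
    (hbD : tsupport b ⊆ P.D) (ν : Fin 2) :
    P.IsTestForm (oneForm (Pi.single ν b)) := by
  have h : ∀ z, z ∉ tsupport b → (oneForm (Pi.single ν b) : Tens V 1) z = 0 := by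
    intro z hz
    funext a
    unfold oneForm
    rcases a 0 with μ | i
    · rfl
    · rcases eq_or_ne i ν with rfl | hi
      · simp [image_eq_zero_of_notMem_tsupport hz]
      · simp [Pi.single_eq_of_ne hi]
  refine ⟨isForm_oneForm fun i => ?_, HasCompactSupport.intro hbc h,
    (tsupport_subset_of_eq_zero (isClosed_tsupport b) h).trans hbD⟩
  rcases eq_or_ne i ν with rfl | hi
  · simpa using hb.contDiffOn
  · rw [Pi.single_eq_of_ne hi]
    exact contDiffOn_const

omit [FiniteDimensional ℝ V] in
-- The factor `2 / det h` of the norm meets the density `4 det h`: the `L²` pairing of `(0,2)`-forms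
-- does not see the metric.
theorem tensIP_two_vol {β χ : Tens V 2} (hβ : IsForm P.D β) (hχ : IsForm P.D χ) {z : C2}
    (hz : z ∈ P.D) : P.tensIP z (β z) (χ z) * (P.vol z : ℂ)
      = 8 * P.ipC (β z topIdx) (χ z topIdx) := by
  have h0 := hR.hermDet_ne hz
  rw [show β z = fun a => eps a • β z topIdx from funext (hβ.eq_eps hz),
    show χ z = fun a => eps a • χ z topIdx from funext (hχ.eq_eps hz), tensIP_eps hR hz,
    hR.vol_eq hz]
  simp only [eps_topIdx, one_smul]
  field_simp
  ring

omit [FiniteDimensional ℝ V] hR in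
theorem _root_.KahlerYM.Patch.IsForm.eq_oneForm {D : Set C2} {χ : Tens V 1} (hχ : IsForm D χ)
    {z : C2} (hz : z ∈ D) : χ z = oneForm (fun ν w => χ w ![Sum.inr ν]) z := by
  funext a
  obtain ⟨x, rfl⟩ : ∃ x, a = ![x] := ⟨a 0, by funext i; rw [Subsingleton.elim i 0]; rfl⟩
  rcases x with μ | ν
  · rw [hχ.type z hz _ fun h => by simpa using h 0]
    rfl
  · rfl

omit [FiniteDimensional ℝ V] in
-- The determinants cancel again and leave the cofactors; these are transposed on entering the
-- conjugate linear slot.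
theorem tensIP_one_vol {β χ : Tens V 1} (hβ : IsForm P.D β) (hχ : IsForm P.D χ) {z : C2}
    (hz : z ∈ P.D) : P.tensIP z (β z) (χ z) * (P.vol z : ℂ)
      = 4 * ∑ ν, P.ipC (β z ![Sum.inr ν]) (∑ μ, P.cof μ ν z • χ z ![Sum.inr μ]) := by
  have h0 := hR.hermDet_ne hz
  rw [hβ.eq_oneForm hz, hχ.eq_oneForm hz, tensIP_oneForm hR hz, hR.vol_eq hz]
  simp only [hR.ipC_add_right, hR.ipC_smul_right, hR.conj_cof hz, Fin.sum_univ_two, oneForm,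
    Matrix.cons_val_fin_one, Sum.elim_inr]
  field_simp

theorem eq_of_tensIP_two {χ₁ χ₂ : Tens V 2} (h₁ : IsForm P.D χ₁) (h₂ : IsForm P.D χ₂)
    (h : ∀ β : Tens V 2, P.IsTestForm β →
      ∫ z in P.D, P.tensIP z (β z) (χ₁ z) * (P.vol z : ℂ)
        = ∫ z in P.D, P.tensIP z (β z) (χ₂ z) * (P.vol z : ℂ)) {z : C2} (hz : z ∈ P.D) :
    χ₁ z = χ₂ z := by
  have key : χ₁ z topIdx = χ₂ z topIdx := by
    refine hR.eq_of_integral hR.isOpen (h₁.smooth topIdx) (h₂.smooth topIdx)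
      (c := 8) (by norm_num) ?_ hz
    intro b hb hbc hbD
    have := h _ (hR.isTestForm_eps hb hbc hbD)
    rw [setIntegral_congr_fun hR.isOpen.measurableSet fun z hz =>
        hR.tensIP_two_vol (isForm_eps hb.contDiffOn) h₁ hz,
      setIntegral_congr_fun hR.isOpen.measurableSet fun z hz =>
        hR.tensIP_two_vol (isForm_eps hb.contDiffOn) h₂ hz] at this
    simpa only [eps_topIdx, one_smul] using this
  funext a
  rw [h₁.eq_eps hz, h₂.eq_eps hz, key]

/-- Testing one component at a time identifies the cofactor combinations of `χ₁` and `χ₂`; the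
cofactor matrix is then inverted. -/
theorem eq_of_tensIP_one {χ₁ χ₂ : Tens V 1} (h₁ : IsForm P.D χ₁) (h₂ : IsForm P.D χ₂)
    (h : ∀ β : Tens V 1, P.IsTestForm β →
      ∫ z in P.D, P.tensIP z (β z) (χ₁ z) * (P.vol z : ℂ)
        = ∫ z in P.D, P.tensIP z (β z) (χ₂ z) * (P.vol z : ℂ)) {z : C2} (hz : z ∈ P.D) :
    χ₁ z = χ₂ z := by
  have hsm : ∀ {χ : Tens V 1}, IsForm P.D χ → ∀ ν, ContDiffOn ℝ ∞
      (fun z => ∑ μ, P.cof μ ν z • χ z ![Sum.inr μ]) P.D := fun hχ ν =>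
    ContDiffOn.sum fun μ _ => contDiffOn_csmul (hR.smooth_cof μ ν) (hχ.smooth _)
  have key : ∀ ν, ∑ μ, P.cof μ ν z • χ₁ z ![Sum.inr μ] = ∑ μ, P.cof μ ν z • χ₂ z ![Sum.inr μ] := by
    intro ν
    refine hR.eq_of_integral hR.isOpen (hsm h₁ ν) (hsm h₂ ν) (c := 4) (by norm_num) ?_ hz
    intro b hb hbc hbD
    have ht := hR.isTestForm_oneForm hb hbc hbD ν
    have hf : IsForm P.D (oneForm (Pi.single ν b)) :=
      ⟨fun a => (ht.isForm.smooth a).mono (Set.subset_univ _),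
        fun z _ => ht.isForm.alternating z trivial, fun z _ => ht.isForm.type z trivial⟩
    have := h _ ht
    rw [setIntegral_congr_fun hR.isOpen.measurableSet fun z hz => hR.tensIP_one_vol hf h₁ hz,
      setIntegral_congr_fun hR.isOpen.measurableSet fun z hz =>
        hR.tensIP_one_vol hf h₂ hz] at this
    have e : ∀ (y : Fin 2 → C2 → Cx V) z, ∑ i, P.ipC
        ((oneForm (Pi.single ν b) : Tens V 1) z ![Sum.inr i]) (y i z) = P.ipC (b z) (y ν z) := by
      intro y z
      rw [Finset.sum_eq_single ν]
      · simp [oneForm]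
      · intro i _ hi
        simp [oneForm, Pi.single_eq_of_ne hi, hR.ipC_zero]
      · simp
    simpa only [e (fun ν z => ∑ μ, P.cof μ ν z • χ₁ z ![Sum.inr μ]),
      e (fun ν z => ∑ μ, P.cof μ ν z • χ₂ z ![Sum.inr μ])] using this
  have k0 := key 0
  have k1 := key 1
  simp only [Fin.sum_univ_two, cof, Matrix.cons_val_zero, Matrix.cons_val_one] at k0 k1
  have h0 := hR.hermDet_ne hz
  -- Multiplying the adjugate by the matrix itself gives the determinant, which is nonzero.
  have e0 : P.hermDet z • χ₁ z ![Sum.inr 0] = P.hermDet z • χ₂ z ![Sum.inr 0] := by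
    rw [hermDet]
    linear_combination (norm := module) P.herm 0 0 z • k0 + P.herm 1 0 z • k1
  have e1 : P.hermDet z • χ₁ z ![Sum.inr 1] = P.hermDet z • χ₂ z ![Sum.inr 1] := by
    rw [hermDet]
    linear_combination (norm := module) P.herm 0 1 z • k0 + P.herm 1 1 z • k1
  rw [h₁.eq_oneForm hz, h₂.eq_oneForm hz]
  funext a
  unfold oneForm
  rcases a 0 with μ | ν
  · rfl
  · fin_cases ν
    · exact smul_right_injective _ h0 e0
    · exact smul_right_injective _ h0 e1

end IsRegular

end Patch

/-! ### Divergence of the inverse metric. -/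

namespace Patch

variable {V : Type*} [NormedAddCommGroup V] [NormedSpace ℝ V]
  {P : Patch V}

/-- The components `g^{ν̄μ}` of the inverse metric. -/
def invHerm (P : Patch V) (ν μ : Fin 2) (z : C2) : ℂ := (P.hermDet z)⁻¹ * P.cof ν μ z

namespace IsRegular

variable (hR : P.IsRegular)
include hR

theorem smooth_invHerm (ν μ : Fin 2) : ContDiffOn ℝ ∞ (P.invHerm ν μ) P.D :=
  hR.smooth_hermDet_inv.mul (hR.smooth_cof ν μ)

variable {z : C2} (hz : z ∈ P.D)
include hz

theorem diff_invHerm (ν μ : Fin 2) : DifferentiableAt ℝ (P.invHerm ν μ) z :=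
  differentiableAt_of_isOpen hR.isOpen (hR.smooth_invHerm ν μ) hz

theorem conj_invHerm (ν μ : Fin 2) : conj (P.invHerm ν μ z) = P.invHerm μ ν z := by
  rw [invHerm, invHerm, map_mul, map_inv₀, hR.conj_hermDet hz, hR.conj_cof hz]

theorem conj_gam (ν : Fin 2) :
    conj (P.gam ν z) = (P.hermDet z)⁻¹ * pd (Sum.inl ν) P.hermDet z := by
  rw [gam, map_mul, map_inv₀, hR.conj_hermDet hz, ← pd_conj]
  congr 1
  exact pd_congr_on hR.isOpen (fun y hy => hR.conj_hermDet hy) hz _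

theorem pd_invHerm (a : Idx) (ν μ : Fin 2) : pd a (P.invHerm ν μ) z
    = -(P.invHerm ν μ z * ((P.hermDet z)⁻¹ * pd a P.hermDet z))
      + (P.hermDet z)⁻¹ * pd a (P.cof ν μ) z := by
  have h := pd_mul a (hR.diff_hermDet_inv hz) (hR.diff_cof hz ν μ)
  rw [pd_inv a (hR.diff_hermDet hz) (hR.hermDet_ne hz)] at h
  refine h.trans ?_
  rw [invHerm]
  ring

/-- Since the cofactors are divergence free, only the derivative of `1 / det h` survives. This is
the source of every `gam` term in the adjoints. -/
theorem sum_pd_invHerm_inr (μ : Fin 2) :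
    ∑ ν, pd (Sum.inr ν) (P.invHerm ν μ) z = -∑ ν, P.invHerm ν μ z * P.gam ν z := by
  simp only [hR.pd_invHerm hz, Finset.sum_add_distrib, ← Finset.mul_sum, hR.sum_pd_cof_inr hz,
    mul_zero, add_zero, Finset.sum_neg_distrib]
  rfl

theorem sum_pd_invHerm_inl (ν : Fin 2) :
    ∑ μ, pd (Sum.inl μ) (P.invHerm ν μ) z = -∑ μ, P.invHerm ν μ z * conj (P.gam μ z) := by
  simp only [hR.pd_invHerm hz, Finset.sum_add_distrib, ← Finset.mul_sum, hR.sum_pd_cof_inl hz,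
    mul_zero, add_zero, Finset.sum_neg_distrib, hR.conj_gam hz]

end IsRegular

/-! ### The formal adjoints -/

variable [FiniteDimensional ℝ V]

/-- The formal adjoint of the covariant derivative, in terms of the component `0̄ 1̄`. -/
def nablaAdj (P : Patch V) (w : Idx → C2 → Cx V) (z : C2) : Cx V :=
  -∑ ν, ∑ μ, P.invHerm μ ν z • (P.covK (Sum.inl ν) (w (Sum.inr μ)) z
    + P.covK (Sum.inr μ) (w (Sum.inl ν)) z)

/-- The formal adjoint of `∂̄_A` on `(0,2)`-forms. -/
def dbarAdj (P : Patch V) (u : C2 → Cx V) : Tens V 1 :=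
  oneForm ![fun z => ∑ μ, P.invHerm 1 μ z • P.covD (Sum.inl μ) u z,
    fun z => -∑ μ, P.invHerm 0 μ z • P.covD (Sum.inl μ) u z]

omit [FiniteDimensional ℝ V] in
theorem IsForm.mono {k : ℕ} {D D' : Set C2} (h : D' ⊆ D) {T : Tens V k} (hT : IsForm D T) :
    IsForm D' T :=
  ⟨fun a => (hT.smooth a).mono h, fun z hz => hT.alternating z (h hz),
    fun z hz => hT.type z (h hz)⟩

theorem IsTestForm.isForm_dom {k : ℕ} {β : Tens V k} (hβ : P.IsTestForm β) : IsForm P.D β :=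
  hβ.isForm.mono (Set.subset_univ _)

namespace IsRegular

variable (hR : P.IsRegular)
include hR

theorem smooth_covK (a : Idx) {u : C2 → Cx V} (hu : ContDiffOn ℝ ∞ u P.D) :
    ContDiffOn ℝ ∞ (P.covK a u) P.D := by
  refine (hR.smooth_covD a hu).sub (contDiffOn_csmul ?_ hu)
  rcases a with μ | ν
  · exact contDiffOn_const
  · exact hR.smooth_gam ν

theorem smooth_nablaAdj {w : Idx → C2 → Cx V} (hw : ∀ c, ContDiffOn ℝ ∞ (w c) P.D) :
    ContDiffOn ℝ ∞ (P.nablaAdj w) P.D :=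
  (ContDiffOn.sum fun ν _ => ContDiffOn.sum fun μ _ => contDiffOn_csmul (hR.smooth_invHerm μ ν)
    ((hR.smooth_covK _ (hw _)).add (hR.smooth_covK _ (hw _)))).neg

theorem pd_smul_ipC (a : Idx) {c : C2 → ℂ} {u v : C2 → Cx V} {z : C2}
    (hc : DifferentiableAt ℝ c z) (hu : DifferentiableAt ℝ u z) (hv : DifferentiableAt ℝ v z) :
    pd a (fun z => c z * P.ipC (u z) (v z)) z = pd a c z * P.ipC (u z) (v z)
      + c z * (P.ipC (P.covD a u z) (v z) + P.ipC (u z) (P.covD (bar a) v z)) := by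
  have hd : DifferentiableAt ℝ (fun z => P.ipC (u z) (v z)) z :=
    ((LinearMap.toContinuousBilinearMap hR.ipBilin).hasFDerivAt_of_bilinear hu.hasFDerivAt
      hv.hasFDerivAt).differentiableAt
  rw [pd_mul a hc hd, hR.pd_ipC_cov a hu hv]

/-- The product rule, with unitarity of the connection. The derivatives of the inverse metric match
the `gam` terms of `covK` on `b` in the barred directions, and their conjugates from `covK` on `w`
in the unbarred ones. -/
theorem nabla_divergence {b : C2 → Cx V} {w : Idx → C2 → Cx V} (hb : ContDiffOn ℝ ∞ b P.D)
    (hw : ∀ c, ContDiffOn ℝ ∞ (w c) P.D) {z : C2} (hz : z ∈ P.D) :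
    ∑ ν, ∑ μ, P.invHerm ν μ z * (P.ipC (P.covK (Sum.inr ν) b z) (w (Sum.inr μ) z)
        + P.ipC (P.covK (Sum.inl μ) b z) (w (Sum.inl ν) z))
      = P.ipC (b z) (P.nablaAdj w z)
        + ∑ a, pd a (Sum.elim
          (fun μ z => ∑ ν, P.invHerm ν μ z * P.ipC (b z) (w (Sum.inl ν) z))
          (fun ν z => ∑ μ, P.invHerm ν μ z * P.ipC (b z) (w (Sum.inr μ) z)) a) z := by
  have db : DifferentiableAt ℝ b z := differentiableAt_of_isOpen hR.isOpen hb hz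
  have dw : ∀ c, DifferentiableAt ℝ (w c) z := fun c =>
    differentiableAt_of_isOpen hR.isOpen (hw c) hz
  have dk : ∀ ν μ c, DifferentiableAt ℝ (fun z => P.invHerm ν μ z * P.ipC (b z) (w c z)) z :=
    fun ν μ c => differentiableAt_of_isOpen hR.isOpen
      ((hR.smooth_invHerm ν μ).mul (hR.smooth_ipC hb (hw c))) hz
  have hsubl : ∀ x y v : Cx V, P.ipC (x - y) v = P.ipC x v - P.ipC y v := fun x y v =>
    congrArg (fun L => L v) (map_sub hR.ipBilin x y)
  rw [Fintype.sum_sum_type]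
  simp only [Sum.elim_inl, Sum.elim_inr]
  simp only [pd_sum _ Finset.univ fun ν _ => dk ν _ _, pd_sum _ Finset.univ fun μ _ => dk _ μ _,
    hR.pd_smul_ipC _ (hR.diff_invHerm hz _ _) db (dw _), nablaAdj, covK, gamIdx, Sum.elim_inl,
    Sum.elim_inr, hR.ipC_neg_right, hR.ipC_sum_right, hR.ipC_smul_right, hR.ipC_add_right,
    hR.ipC_sub_right, hsubl, hR.ipC_smul, hR.conj_invHerm hz, bar, Sum.swap_inl, Sum.swap_inr,
    map_zero, zero_mul, sub_zero]
  have d0 := hR.sum_pd_invHerm_inr hz 0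
  have d1 := hR.sum_pd_invHerm_inr hz 1
  have d2 := hR.sum_pd_invHerm_inl hz 0
  have d3 := hR.sum_pd_invHerm_inl hz 1
  simp only [Fin.sum_univ_two] at d0 d1 d2 d3 ⊢
  linear_combination (-P.ipC (b z) (w (Sum.inr 0) z)) * d0 - P.ipC (b z) (w (Sum.inr 1) z) * d1
    - P.ipC (b z) (w (Sum.inl 0) z) * d2 - P.ipC (b z) (w (Sum.inl 1) z) * d3

omit [FiniteDimensional ℝ V] in
theorem tensIP_three_vol {S T : Tens V 3} {x y : Idx → Cx V} {z : C2} (hz : z ∈ P.D)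
    (hS : ∀ a, S z a = eps (Fin.tail a) • x (a 0)) (hT : ∀ a, T z a = eps (Fin.tail a) • y (a 0)) :
    P.tensIP z (S z) (T z) * (P.vol z : ℂ) = 8 * ∑ ν, ∑ μ, P.invHerm ν μ z *
      (P.ipC (x (Sum.inr ν)) (y (Sum.inr μ)) + P.ipC (x (Sum.inl μ)) (y (Sum.inl ν))) := by
  have h0 := hR.hermDet_ne hz
  rw [show S z = _ from funext hS, show T z = _ from funext hT, tensIP_eps_succ hR hz,
    hR.vol_eq hz]
  unfold invHerm
  generalize (∑ ν, ∑ μ, (P.hermDet z)⁻¹ * P.cof ν μ z *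
      (P.ipC (x (Sum.inr ν)) (y (Sum.inr μ)) + P.ipC (x (Sum.inl μ)) (y (Sum.inl ν)))) = s
  field_simp
  ring

theorem isNablaStar {ψ : Tens V 3} {w : Idx → C2 → Cx V} (hw : ∀ c, ContDiffOn ℝ ∞ (w c) P.D)
    (hψ : ∀ z ∈ P.D, ∀ a, ψ z a = eps (Fin.tail a) • w (a 0) z) :
    P.IsNablaStar ψ (fun z a => eps a • P.nablaAdj w z) where
  isForm := isForm_eps (hR.smooth_nablaAdj hw)
  adjoint β hβ := by
    have hf := hβ.isForm_dom
    have hb := hf.smooth topIdx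
    have hχ : IsForm P.D (fun z (a : Fin 2 → Idx) => eps a • P.nablaAdj w z : Tens V 2) :=
      isForm_eps (hR.smooth_nablaAdj hw)
    have hb0 : ∀ z, z ∉ tsupport β → β z topIdx = 0 := fun z hz => by
      rw [image_eq_zero_of_notMem_tsupport hz]
      rfl
    rw [setIntegral_congr_fun hR.isOpen.measurableSet fun z hz =>
        hR.tensIP_three_vol (x := fun c => P.covK c (fun w => β w topIdx) z) (y := fun c => w c z)
          hz (hf.nabla_eq hR hz) (hψ z hz),
      setIntegral_congr_fun hR.isOpen.measurableSet fun z hz => hR.tensIP_two_vol hf hχ hz,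
      integral_const_mul, integral_const_mul]
    simp only [eps_topIdx, one_smul]
    congr 1
    refine integral_eq_of_divergence hR.isOpen hβ.compact hβ.support (X := Sum.elim
          (fun μ z => ∑ ν, P.invHerm ν μ z * P.ipC (β z topIdx) (w (Sum.inl ν) z))
          (fun ν z => ∑ μ, P.invHerm ν μ z * P.ipC (β z topIdx) (w (Sum.inr μ) z))) ?_ ?_
      (hR.smooth_ipC hb (hR.smooth_nablaAdj hw)).continuousOn
      (fun z _ hz => by rw [hb0 z hz, hR.ipC_zero])
      (fun z hz => hR.nabla_divergence hb hw hz)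
    · rintro (μ | ν)
      · exact ContDiffOn.sum fun ν _ => (hR.smooth_invHerm _ _).mul (hR.smooth_ipC hb (hw _))
      · exact ContDiffOn.sum fun ν _ => (hR.smooth_invHerm _ _).mul (hR.smooth_ipC hb (hw _))
    · rintro (μ | ν) z - hz <;> simp [hb0 z hz, hR.ipC_zero]

theorem nablaBar_eq {T : Tens V 2} (hT : IsForm P.D T) {z : C2} (hz : z ∈ P.D) (a : Fin 3 → Idx) :
    P.nablaBar T z a = eps (Fin.tail a) • (Sum.elim (fun _ _ => 0)
      (fun ν => P.covK (Sum.inr ν) (fun w => T w topIdx)) (a 0) : C2 → Cx V) z := by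
  rw [nablaBar, hT.nabla_eq hR hz]
  rcases a 0 with μ | ν <;> simp

/-- A `ψ` whose first index is of type `(0,1)` is orthogonal to the `(1,0)`-part of `∇β`, so on such
tensors the two adjoints agree. -/
theorem isNablaBarStar {ψ : Tens V 3} {w : Fin 2 → C2 → Cx V} {χ : Tens V 2}
    (hψ : ∀ z ∈ P.D, ∀ a, ψ z a
      = eps (Fin.tail a) • (Sum.elim (fun _ _ => 0) w (a 0) : C2 → Cx V) z)
    (h : P.IsNablaStar ψ χ) : P.IsNablaBarStar ψ χ where
  isForm := h.isForm
  adjoint β hβ := by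
    rw [← h.adjoint β hβ]
    refine setIntegral_congr_fun hR.isOpen.measurableSet fun z hz => ?_
    have hf := hβ.isForm_dom
    change P.tensIP z (P.nablaBar β z) (ψ z) * (P.vol z : ℂ)
      = P.tensIP z (P.nabla β z) (ψ z) * (P.vol z : ℂ)
    rw [hR.tensIP_three_vol (x := fun c => (Sum.elim (fun _ _ => 0)
        (fun ν => P.covK (Sum.inr ν) (fun w => β w topIdx)) c : C2 → Cx V) z)
        (y := fun c => (Sum.elim (fun _ _ => 0) w c : C2 → Cx V) z) hz
        (hR.nablaBar_eq hf hz) (hψ z hz),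
      hR.tensIP_three_vol (x := fun c => P.covK c (fun w => β w topIdx) z) (y := fun c => (Sum.elim (fun _ _ => 0) w c : C2 → Cx V) z)
        hz (hf.nabla_eq hR hz) (hψ z hz)]
    simp only [Sum.elim_inl, Sum.elim_inr, hR.ipC_zero_right]

theorem isForm_dbarAdj {u : C2 → Cx V} (hu : ContDiffOn ℝ ∞ u P.D) :
    IsForm P.D (P.dbarAdj u) := by
  have h : ∀ i : Fin 2, ContDiffOn ℝ ∞
      (fun z => ∑ μ, P.invHerm i μ z • P.covD (Sum.inl μ) u z) P.D := fun i =>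
    ContDiffOn.sum fun μ _ => contDiffOn_csmul (hR.smooth_invHerm i μ) (hR.smooth_covD _ hu)
  refine isForm_oneForm fun ν => ?_
  fin_cases ν
  · exact h 1
  · exact (h 0).neg

omit [FiniteDimensional ℝ V] in
-- The components of `dbarAdj` solve this linear system, whose right side is what integration by
-- parts dictates; the solution is checked with `det (cof) = det h`.
theorem sum_cof_dbarAdj (u : C2 → Cx V) {z : C2} (hz : z ∈ P.D) (ν : Fin 2) :
    ∑ μ, P.cof μ ν z • P.dbarAdj u z ![Sum.inr μ]
      = (![P.covD (Sum.inl 1) u z, -P.covD (Sum.inl 0) u z] : Fin 2 → Cx V) ν := by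
  have h0 := hR.hermDet_ne hz
  have hc : P.cof 0 0 z * P.cof 1 1 z - P.cof 0 1 z * P.cof 1 0 z = P.hermDet z := by
    simp only [cof, hermDet, Matrix.cons_val_zero, Matrix.cons_val_one]
    ring
  have hc' : (P.hermDet z)⁻¹ * (P.cof 0 0 z * P.cof 1 1 z - P.cof 0 1 z * P.cof 1 0 z) = 1 := by
    rw [hc, inv_mul_cancel₀ h0]
  simp only [Fin.sum_univ_two, dbarAdj, oneForm, Matrix.cons_val_fin_one, Sum.elim_inr,
    Matrix.cons_val_zero, Matrix.cons_val_one, invHerm]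
  fin_cases ν
  · simp only [Fin.zero_eta, Matrix.cons_val_zero]
    conv_rhs => rw [← one_smul ℂ (P.covD (Sum.inl 1) u z), ← hc']
    module
  · simp only [Fin.mk_one, Matrix.cons_val_one, Matrix.cons_val_zero]
    conv_rhs => rw [← one_smul ℂ (P.covD (Sum.inl 0) u z), ← hc']
    module

omit [FiniteDimensional ℝ V] hR in
theorem formIP_one (z : C2) (S T : (Fin 1 → Idx) → Cx V) : P.formIP z S T = P.tensIP z S T := by
  simp [formIP]

/-- After multiplication by the density both integrands have the constant weight `4` (for
`(0,2)`-forms as `8 / 2!`), so no derivative of the metric appears. -/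
theorem isDbarStar {f : Tens V 2} (hf : IsForm P.D f) :
    P.IsDbarStar f (P.dbarAdj fun z => f z topIdx) where
  isForm := hR.isForm_dbarAdj (hf.smooth topIdx)
  adjoint β hβ := by
    have hu := hf.smooth topIdx
    have hβf := hβ.isForm_dom
    have hb : ∀ ν, ContDiffOn ℝ ∞ (fun z => β z ![Sum.inr ν]) P.D := fun ν => hβf.smooth _
    have hβ0 : ∀ z, z ∉ tsupport β → ∀ a, β z a = 0 := fun z hz a => by
      rw [image_eq_zero_of_notMem_tsupport hz]
      rfl
    have hH : ∀ z ∈ P.D, P.formIP z (β z) (P.dbarAdj (fun z => f z topIdx) z) * (P.vol z : ℂ)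
        = 4 * (P.ipC (β z ![Sum.inr 0]) (P.covD (Sum.inl 1) (fun z => f z topIdx) z)
          + P.ipC (β z ![Sum.inr 1]) (-P.covD (Sum.inl 0) (fun z => f z topIdx) z)) := by
      intro z hz
      rw [formIP_one, hR.tensIP_one_vol hβf (hR.isForm_dbarAdj hu) hz]
      simp only [hR.sum_cof_dbarAdj _ hz, Fin.sum_univ_two, Matrix.cons_val_zero,
        Matrix.cons_val_one]
    have hF : ∀ z ∈ P.D, P.formIP z (P.dbar β z) (f z) * (P.vol z : ℂ)
        = 4 * P.ipC (P.covD (Sum.inr 0) (fun w => β w ![Sum.inr 1]) z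
          - P.covD (Sum.inr 1) (fun w => β w ![Sum.inr 0]) z) (f z topIdx) := by
      intro z hz
      have h0 := hR.hermDet_ne hz
      rw [formIP, show P.dbar β z = _ from funext (dbar_one β z),
        show f z = fun a => eps a • f z topIdx from funext (hf.eq_eps hz), tensIP_eps hR hz,
        hR.vol_eq hz]
      simp only [eps_topIdx, one_smul]
      norm_num
      field_simp
    rw [setIntegral_congr_fun hR.isOpen.measurableSet hH]
    refine integral_eq_of_divergence hR.isOpen hβ.compact hβ.support (X := Sum.elim (fun _ _ => 0)
      ![fun z => 4 * P.ipC (β z ![Sum.inr 1]) (f z topIdx),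
        fun z => (-4) * P.ipC (β z ![Sum.inr 0]) (f z topIdx)]) ?_ ?_ ?_ ?_ ?_
    · rintro (μ | ν)
      · exact contDiffOn_const
      · fin_cases ν
        · exact contDiffOn_const.mul (hR.smooth_ipC (hb 1) hu)
        · exact contDiffOn_const.mul (hR.smooth_ipC (hb 0) hu)
    · rintro (μ | ν) z - hz
      · rfl
      · fin_cases ν <;> simp [hβ0 z hz, hR.ipC_zero]
    · exact (contDiffOn_const.mul ((hR.smooth_ipC (hb 0) (hR.smooth_covD _ hu)).add
        (hR.smooth_ipC (hb 1) (hR.smooth_covD _ hu).neg))).continuousOn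
    · intro z _ hz
      simp [hβ0 z hz, hR.ipC_zero]
    · intro z hz
      have db : ∀ ν, DifferentiableAt ℝ (fun z => β z ![Sum.inr ν]) z := fun ν =>
        differentiableAt_of_isOpen hR.isOpen (hb ν) hz
      have du : DifferentiableAt ℝ (fun z => f z topIdx) z :=
        differentiableAt_of_isOpen hR.isOpen hu hz
      have hsubl : ∀ x y v : Cx V, P.ipC (x - y) v = P.ipC x v - P.ipC y v := fun x y v =>
        congrArg (fun L => L v) (map_sub hR.ipBilin x y)
      rw [hF z hz, Fintype.sum_sum_type]
      simp only [Sum.elim_inl, Sum.elim_inr, Fin.sum_univ_two, Matrix.cons_val_zero,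
        Matrix.cons_val_one, pd_const]
      rw [hR.pd_smul_ipC (Sum.inr 0) (differentiableAt_const _) (db 1) du,
        hR.pd_smul_ipC (Sum.inr 1) (differentiableAt_const _) (db 0) du]
      simp only [pd_const, hsubl, hR.ipC_neg_right, bar, Sum.swap_inr]
      ring

end IsRegular

end Patch

namespace Patch

variable {V : Type*} [NormedAddCommGroup V] [NormedSpace ℝ V] [FiniteDimensional ℝ V]
  {P : Patch V}

namespace IsRegular

variable (hR : P.IsRegular)
include hR

/-! ### The values of the formal adjoints -/

/-- The operator is a chosen witness, so its values come from uniqueness, and only on the domain of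
the patch. -/
theorem dbarStar_one {ψ : Tens V 2} {χ : Tens V 1} (h : P.IsDbarStar ψ χ) {z : C2}
    (hz : z ∈ P.D) : P.dbarStar ψ z = χ z := by
  have hex : ∃ χ, P.IsDbarStar ψ χ := ⟨χ, h⟩
  rw [dbarStar, dif_pos hex]
  refine hR.eq_of_tensIP_one hex.choose_spec.isForm h.isForm (fun β hβ => ?_) hz
  simpa only [formIP_one] using (hex.choose_spec.adjoint β hβ).symm.trans (h.adjoint β hβ)

theorem dbarStar_two {ψ : Tens V 3} {χ : Tens V 2} (h : P.IsDbarStar ψ χ) {z : C2}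
    (hz : z ∈ P.D) : P.dbarStar ψ z = χ z := by
  have hex : ∃ χ, P.IsDbarStar ψ χ := ⟨χ, h⟩
  rw [dbarStar, dif_pos hex]
  refine hR.eq_of_tensIP_two hex.choose_spec.isForm h.isForm (fun β hβ => ?_) hz
  have := (hex.choose_spec.adjoint β hβ).symm.trans (h.adjoint β hβ)
  simp only [formIP, mul_assoc, integral_const_mul] at this
  exact mul_left_cancel₀ (by norm_num) this

theorem nablaStar_two {ψ : Tens V 3} {χ : Tens V 2} (h : P.IsNablaStar ψ χ) {z : C2}
    (hz : z ∈ P.D) : P.nablaStar ψ z = χ z := by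
  have hex : ∃ χ, P.IsNablaStar ψ χ := ⟨χ, h⟩
  rw [nablaStar, dif_pos hex]
  exact hR.eq_of_tensIP_two hex.choose_spec.isForm h.isForm
    (fun β hβ => (hex.choose_spec.adjoint β hβ).symm.trans (h.adjoint β hβ)) hz

theorem nablaBarStar_two {ψ : Tens V 3} {χ : Tens V 2} (h : P.IsNablaBarStar ψ χ) {z : C2}
    (hz : z ∈ P.D) : P.nablaBarStar ψ z = χ z := by
  have hex : ∃ χ, P.IsNablaBarStar ψ χ := ⟨χ, h⟩
  rw [nablaBarStar, dif_pos hex]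
  exact hR.eq_of_tensIP_two hex.choose_spec.isForm h.isForm
    (fun β hβ => (hex.choose_spec.adjoint β hβ).symm.trans (h.adjoint β hβ)) hz

theorem isForm_zero {k : ℕ} : IsForm P.D (0 : Tens V k) where
  smooth _ := contDiffOn_const
  alternating _ _ _ _ := (smul_zero _).symm
  type _ _ _ _ := rfl

theorem isDbarStar_dbar {f : Tens V 2} (hf : IsForm P.D f) : P.IsDbarStar (P.dbar f) 0 where
  isForm := hR.isForm_zero
  adjoint β _ := by
    refine setIntegral_congr_fun hR.isOpen.measurableSet fun z hz => ?_
    have h0 : ∀ a, P.dbar f z a = 0 := hf.dbar_eq_zero hR hz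
    simp [formIP, tensIP, h0, hR.ipC_zero_right]

/-! ### The Weitzenböck formula -/

/-- The `∂̄_A`-Laplacian on `(0,2)`-forms, in terms of the component `0̄ 1̄`. -/
theorem dbar_dbarAdj {u : C2 → Cx V} (hu : ContDiffOn ℝ ∞ u P.D) {z : C2} (hz : z ∈ P.D)
    (a : Fin 2 → Idx) : P.dbar (P.dbarAdj u) z a = eps a • -∑ ν, ∑ μ, P.invHerm ν μ z •
      P.covK (Sum.inr ν) (P.covD (Sum.inl μ) u) z := by
  have hs : ∀ μ, ContDiffOn ℝ ∞ (P.covD (Sum.inl μ) u) P.D := fun μ => hR.smooth_covD _ hu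
  have ds : ∀ μ, DifferentiableAt ℝ (P.covD (Sum.inl μ) u) z := fun μ =>
    differentiableAt_of_isOpen hR.isOpen (hs μ) hz
  have dt : ∀ ν μ, DifferentiableAt ℝ (fun z => P.invHerm ν μ z • P.covD (Sum.inl μ) u z) z :=
    fun ν μ => differentiableAt_of_isOpen hR.isOpen (contDiffOn_csmul (hR.smooth_invHerm ν μ) (hs μ))
      hz
  have hsum : ∀ ν, P.covD (Sum.inr ν) (fun z => ∑ μ, P.invHerm ν μ z • P.covD (Sum.inl μ) u z) z
      = ∑ μ, (pd (Sum.inr ν) (P.invHerm ν μ) z • P.covD (Sum.inl μ) u z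
        + P.invHerm ν μ z • P.covD (Sum.inr ν) (P.covD (Sum.inl μ) u) z) := by
    intro ν
    have h : P.covD (Sum.inr ν) (fun z => ∑ μ, P.invHerm ν μ z • P.covD (Sum.inl μ) u z) z
        = ∑ μ, P.covD (Sum.inr ν) (fun z => P.invHerm ν μ z • P.covD (Sum.inl μ) u z) z := by
      -- Only the outer derivative, in the barred direction, is to be unfolded.
      simp only [covD.eq_1 P (Sum.inr ν), Finset.sum_add_distrib]
      rw [pd_sum _ _ fun μ _ => dt ν μ]
      congr 1
      exact map_sum (hR.brBilin (P.conn z (Sum.inr ν))) _ _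
    rw [h]
    exact Finset.sum_congr rfl fun μ _ => hR.covD_smul _ (hR.diff_invHerm hz ν μ) (ds μ)
  have hneg : ∀ (c : Idx) (v : C2 → Cx V), P.covD c (fun z => -v z) z = -P.covD c v z := by
    intro c v
    have h : P.brC (P.conn z c) (-v z) = -P.brC (P.conn z c) (v z) :=
      map_neg (hR.brBilin (P.conn z c)) _
    rw [covD, covD, pd_neg, h, neg_add]
  rw [dbar_one]
  congr 1
  have e0 : (fun w => P.dbarAdj u w ![Sum.inr 0])
      = fun z => ∑ μ, P.invHerm 1 μ z • P.covD (Sum.inl μ) u z := rfl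
  have e1 : (fun w => P.dbarAdj u w ![Sum.inr 1])
      = fun z => -∑ μ, P.invHerm 0 μ z • P.covD (Sum.inl μ) u z := rfl
  rw [e0, e1, hneg, hsum, hsum]
  -- The terms in which the derivative falls on the inverse metric add up to its divergence, which
  -- supplies the `gam ν` that turns `covD (inr ν)` into `covK (inr ν)`.
  have d0 := hR.sum_pd_invHerm_inr hz 0
  have d1 := hR.sum_pd_invHerm_inr hz 1
  simp only [Fin.sum_univ_two] at d0 d1 ⊢
  have d0' := eq_sub_of_add_eq d0
  have d1' := eq_sub_of_add_eq d1
  rw [d0', d1']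
  simp only [covK, gamIdx, Sum.elim_inr]
  module

/-- The rough Laplacian of the `(0,1)`-part of the covariant derivative. -/
theorem nablaAdj_bar {u : C2 → Cx V} (hu : ContDiffOn ℝ ∞ u P.D) {z : C2} (hz : z ∈ P.D) :
    P.nablaAdj (Sum.elim (fun _ _ => 0) fun ν => P.covK (Sum.inr ν) u) z
      = -∑ ν, ∑ μ, P.invHerm ν μ z • (P.covD (Sum.inl μ) (P.covD (Sum.inr ν) u) z
        - P.gam ν z • P.covD (Sum.inl μ) u z - pd (Sum.inl μ) (P.gam ν) z • u z) := by
  have h0 : ∀ c, P.covK c (fun _ => (0 : Cx V)) z = 0 := by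
    intro c
    have h : P.brC (P.conn z c) 0 = 0 := map_zero (hR.brBilin (P.conn z c))
    simp [covK, covD, h]
  have du : DifferentiableAt ℝ u z := differentiableAt_of_isOpen hR.isOpen hu hz
  have dD : ∀ c, DifferentiableAt ℝ (P.covD c u) z := fun c =>
    differentiableAt_of_isOpen hR.isOpen (hR.smooth_covD c hu) hz
  have dg : ∀ ν, DifferentiableAt ℝ (fun z => P.gam ν z • u z) z := fun ν =>
    differentiableAt_of_isOpen hR.isOpen (contDiffOn_csmul (hR.smooth_gam ν) hu) hz
  have h1 : ∀ ν μ, P.covK (Sum.inl μ) (P.covK (Sum.inr ν) u) z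
      = P.covD (Sum.inl μ) (P.covD (Sum.inr ν) u) z - P.gam ν z • P.covD (Sum.inl μ) u z
        - pd (Sum.inl μ) (P.gam ν) z • u z := by
    intro ν μ
    have e : P.covK (Sum.inl μ) (P.covK (Sum.inr ν) u) z
        = P.covD (Sum.inl μ) (fun z => P.covD (Sum.inr ν) u z - P.gam ν z • u z) z := by
      rw [covK, gamIdx, Sum.elim_inl, zero_smul, sub_zero]
      rfl
    rw [e, hR.covD_sub _ (dD _) (dg ν), hR.covD_smul _ (hR.diff_gam hz ν) du]
    abel
  simp only [nablaAdj, Sum.elim_inl, Sum.elim_inr, h0, h1, add_zero]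
  rw [Finset.sum_comm]

omit [FiniteDimensional ℝ V] in
-- The adjoint is a sum over the two types. The `(1,0)`-part gives the same second order operator as
-- `dbar_dbarAdj`, because `covK` and `covD` agree in unbarred directions.
theorem nablaAdj_covK {u : C2 → Cx V} (z : C2) :
    P.nablaAdj (fun c => P.covK c u) z
      = P.nablaAdj (Sum.elim (fun _ _ => 0) fun ν => P.covK (Sum.inr ν) u) z
        + -∑ ν, ∑ μ, P.invHerm ν μ z • P.covK (Sum.inr ν) (P.covD (Sum.inl μ) u) z := by
  have h0 : ∀ c, P.covK c (fun _ => (0 : Cx V)) z = 0 := by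
    intro c
    have h : P.brC (P.conn z c) 0 = 0 := map_zero (hR.brBilin (P.conn z c))
    simp [covK, covD, h]
  have h1 : ∀ μ, P.covK (Sum.inl μ) u = P.covD (Sum.inl μ) u := by
    intro μ
    funext z
    rw [covK, gamIdx, Sum.elim_inl, zero_smul, sub_zero]
  simp only [nablaAdj, Sum.elim_inl, Sum.elim_inr, h0, h1, add_zero, Fin.sum_univ_two]
  module

/-- The heart of the formula: exchanging `D_ν̄ - γ_ν` with `D_μ` costs `F_{ν̄μ} + ∂_μ γ_ν`, and
contraction with the inverse metric yields `F̂` and the scalar curvature. -/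
theorem laplacian_sub {u : C2 → Cx V} (hu : ContDiffOn ℝ ∞ u P.D) {z : C2} (hz : z ∈ P.D) :
    -∑ ν, ∑ μ, P.invHerm ν μ z • P.covK (Sum.inr ν) (P.covD (Sum.inl μ) u) z
      = P.nablaAdj (Sum.elim (fun _ _ => 0) fun ν => P.covK (Sum.inr ν) u) z
        + Complex.I • P.brC (P.fHat z) (u z) + (2 * P.S z) • u z := by
  have hF : Complex.I • P.brC (P.fHat z) (u z) = -∑ ν, ∑ μ, P.invHerm ν μ z •
      (P.covD (Sum.inr ν) (P.covD (Sum.inl μ) u) z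
        - P.covD (Sum.inl μ) (P.covD (Sum.inr ν) u) z) := by
    simp only [hR.covD_comm hu hz, hR.fHat_eq hz, hR.brC_smul, hR.brC_add, Fin.sum_univ_two,
      smul_smul, ← mul_assoc, Complex.I_mul_I, invHerm]
    module
  rw [hF, hR.nablaAdj_bar hu hz, hR.S_eq hz]
  simp only [covK, gamIdx, Sum.elim_inr, Fin.sum_univ_two, invHerm]
  module

theorem weitzenboeck {f : Tens V 2} (hf : IsForm P.D f) :
    ((∃ χ, P.IsDbarStar f χ) ∧ (∃ χ, P.IsDbarStar (P.dbar f) χ)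
      ∧ (∃ χ, P.IsNablaBarStar (P.nablaBar f) χ) ∧ (∃ χ, P.IsNablaStar (P.nabla f) χ))
    ∧ (∀ z ∈ P.D, ∀ a, P.laplacianDbar f z a
        = P.nablaBarStar (P.nablaBar f) z a
          + Complex.I • P.brC (P.fHat z) (f z a) + (2 * P.S z) • f z a)
    ∧ (∀ z ∈ P.D, ∀ a, (2 : ℂ) • P.laplacianDbar f z a
        = P.nablaStar (P.nabla f) z a
          + Complex.I • P.brC (P.fHat z) (f z a) + (2 * P.S z) • f z a) := by
  have hu := hf.smooth topIdx
  have hd := hR.isDbarStar hf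
  have hd' := hR.isDbarStar_dbar hf
  have hn := hR.isNablaStar (ψ := P.nabla f) (fun c => hR.smooth_covK c hu)
    (fun z hz => hf.nabla_eq hR hz)
  have hb := hR.isNablaBarStar (fun z hz => hR.nablaBar_eq hf hz)
    (hR.isNablaStar (ψ := P.nablaBar f) (by
      rintro (μ | ν)
      · exact contDiffOn_const
      · exact hR.smooth_covK _ hu) (fun z hz => hR.nablaBar_eq hf hz))
  have hlap : ∀ z ∈ P.D, ∀ a, P.laplacianDbar f z a = eps a • -∑ ν, ∑ μ, P.invHerm ν μ z •
      P.covK (Sum.inr ν) (P.covD (Sum.inl μ) fun z => f z topIdx) z := by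
    intro z hz a
    -- The chosen adjoint is known only on `D`; as `D` is open, this determines its derivatives
    -- there.
    have h1 : P.dbar (P.dbarStar f) z a = P.dbar (P.dbarAdj fun z => f z topIdx) z a := by
      have hc : ∀ b, ∀ w ∈ P.D, P.dbarStar f w b = P.dbarAdj (fun z => f z topIdx) w b :=
        fun b w hw => congrFun (hR.dbarStar_one hd hw) b
      rw [dbar_one, dbar_one, hR.covD_congr (hc _) hz, hR.covD_congr (hc _) hz]
    have h2 : P.dbarStar (P.dbar f) z a = 0 := congrFun (hR.dbarStar_two hd' hz) a
    change P.dbar (P.dbarStar f) z a + P.dbarStar (P.dbar f) z a = _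
    rw [h1, h2, add_zero, hR.dbar_dbarAdj hu hz]
  have hbr : ∀ z (c : ℂ) (x : Cx V), Complex.I • P.brC (P.fHat z) (c • x)
      = c • Complex.I • P.brC (P.fHat z) x := fun z c x => by
    rw [hR.brC_smul_right, smul_comm]
  refine ⟨⟨⟨_, hd⟩, ⟨_, hd'⟩, ⟨_, hb⟩, ⟨_, hn⟩⟩, fun z hz a => ?_, fun z hz a => ?_⟩
  · rw [hlap z hz, hR.nablaBarStar_two hb hz, hR.laplacian_sub hu hz, hf.eq_eps hz a, hbr]
    module
  · rw [hlap z hz, hR.nablaStar_two hn hz, hR.nablaAdj_covK, two_smul]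
    -- One copy of the Laplacian is expanded by the first formula; the other remains as the
    -- `(1,0)`-part of the rough Laplacian.
    nth_rewrite 1 [hR.laplacian_sub hu hz]
    rw [hf.eq_eps hz a, hbr]
    module

end IsRegular

end Patch

/-! ### The metric in a holomorphic chart -/

section Surface

variable {M : Type*} [TopologicalSpace M] [ChartedSpace C2 M]

section

variable [IsManifold 𝓘(ℝ, C2) ∞ M] (e : OpenPartialHomeomorph M C2)

theorem mdifferentiable_atlas {e : OpenPartialHomeomorph M C2} (he : e ∈ atlas C2 M) :
    e.MDifferentiable 𝓘(ℝ, C2) 𝓘(ℝ, C2) := by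
  have : IsManifold 𝓘(ℝ, C2) 1 M := IsManifold.of_le (n := ∞) (by simp)
  exact mdifferentiable_of_mem_atlas he

theorem dSymm_injective {e : OpenPartialHomeomorph M C2} (he : e ∈ atlas C2 M) {z : C2}
    (hz : z ∈ e.target) : Function.Injective (dSymm e z) :=
  (mdifferentiable_atlas he).symm.mfderiv_injective hz

omit [IsManifold 𝓘(ℝ, C2) ∞ M] in
theorem dSymm_add (z v w : C2) : dSymm e z (v + w) = dSymm e z v + dSymm e z w :=
  map_add (mfderiv 𝓘(ℝ, C2) 𝓘(ℝ, C2) e.symm z) v w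

omit [IsManifold 𝓘(ℝ, C2) ∞ M] in
theorem dSymm_smul (r : ℝ) (z v : C2) : dSymm e z (r • v) = r • dSymm e z v :=
  map_smul (mfderiv 𝓘(ℝ, C2) 𝓘(ℝ, C2) e.symm z) r v

/-- The tangent map of the inverse chart, applied to a constant vector field. -/
theorem contMDiffOn_dSymm {e : OpenPartialHomeomorph M C2} (he : e ∈ atlas C2 M) (v : C2) :
    ContMDiffOn 𝓘(ℝ, C2) 𝓘(ℝ, C2).tangent ∞
      (fun z => (⟨e.symm z, dSymm e z v⟩ : TangentBundle 𝓘(ℝ, C2) M)) e.target := by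
  have h1 : ContMDiffOn 𝓘(ℝ, C2) 𝓘(ℝ, C2) ∞ e.symm e.target :=
    contMDiffOn_symm_of_mem_maximalAtlas (IsManifold.subset_maximalAtlas he)
  have h2 := h1.contMDiffOn_tangentMapWithin (m := ∞) (by simp) e.open_target.uniqueMDiffOn
  have h3 : ContMDiffOn 𝓘(ℝ, C2) 𝓘(ℝ, C2).tangent ∞
      (fun z => (⟨z, v⟩ : TangentBundle 𝓘(ℝ, C2) C2)) e.target :=
    contMDiffOn_vectorSpace_iff_contDiffOn.2 contDiffOn_const
  refine (h2.comp h3 fun z hz => hz).congr fun z hz => ?_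
  simp only [Function.comp_apply, tangentMapWithin, mfderivWithin_of_isOpen e.open_target hz]
  rfl

theorem Metric.smooth_loc (g : Metric M) {e : OpenPartialHomeomorph M C2} (he : e ∈ atlas C2 M)
    (v w : C2) : ContDiffOn ℝ ∞ (fun z => g.loc e z v w) e.target := by
  have h1 : ContMDiffOn 𝓘(ℝ, C2) 𝓘(ℝ, C2) ∞ e.symm e.target :=
    contMDiffOn_symm_of_mem_maximalAtlas (IsManifold.subset_maximalAtlas he)
  -- The metric, pulled back along the inverse chart, is evaluated on two smooth fields; the value
  -- is a section of the trivial line bundle, whose fibre coordinate is the required function.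
  have h : ContMDiffOn 𝓘(ℝ, C2) (𝓘(ℝ, C2).prod 𝓘(ℝ, ℝ)) ∞
      (fun z => Bundle.TotalSpace.mk' ℝ (E := Bundle.Trivial M ℝ) (e.symm z)
        (g.inner (e.symm z) (dSymm e z v) (dSymm e z w))) e.target :=
    ContMDiffOn.clm_bundle_apply₂ (F₁ := C2) (F₂ := C2) (F₃ := ℝ) (𝕜 := ℝ)
      (E₁ := fun x : M => TangentSpace 𝓘(ℝ, C2) x) (E₂ := fun x : M => TangentSpace 𝓘(ℝ, C2) x)
      (E₃ := Bundle.Trivial M ℝ) (b := fun z => e.symm z)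
      (ψ := fun z => g.inner (e.symm z)) (v := fun z => dSymm e z v) (w := fun z => dSymm e z w)
      (g.contMDiff.comp_contMDiffOn h1) (contMDiffOn_dSymm he v) (contMDiffOn_dSymm he w)
  intro z hz
  have h2 := h z hz
  rw [Bundle.contMDiffWithinAt_totalSpace] at h2
  exact h2.2.contDiffWithinAt

end

end Surface

/-! ### The Lie algebra -/

section LieGroup

variable {m : ℕ} {G : Type*} [TopologicalSpace G] [ChartedSpace (Vm m) G] [Group G]
  [LieGroup 𝓘(ℝ, Vm m) ∞ G]

instance : FiniteDimensional ℝ (GroupLieAlgebra 𝓘(ℝ, Vm m) G) :=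
  inferInstanceAs (FiniteDimensional ℝ (Vm m))

/-- Cartan's criterion in characteristic zero. -/
theorem negKilling_nondeg [LieAlgebra.IsSemisimple ℝ (GroupLieAlgebra 𝓘(ℝ, Vm m) G)] (y : Vm m)
    (h : ∀ x, negKilling G x y = 0) : y = 0 :=
  (LieAlgebra.IsKilling.killingForm_nondegenerate ℝ (GroupLieAlgebra 𝓘(ℝ, Vm m) G)).2 y
    fun x => neg_eq_zero.1 (h x)

end LieGroup

/-! ### Charts and trivialisations of the global data give regular patches. -/

section Bundle

variable {m : ℕ} {G : Type*} [TopologicalSpace G] [ChartedSpace (Vm m) G] [Group G]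
  [LieGroup 𝓘(ℝ, Vm m) ∞ G]
  {M : Type*} [TopologicalSpace M] [ChartedSpace C2 M] {ι : Type*} {P : PrincipalBundle m G M ι}

omit [LieGroup 𝓘(ℝ, Vm m) ∞ G] in
theorem PrincipalBundle.isOpen_dom (P : PrincipalBundle m G M ι) (e : OpenPartialHomeomorph M C2)
    (i : ι) : IsOpen (P.dom e i) :=
  e.symm.isOpen_inter_preimage (P.isOpen i)

theorem Connection.isLieData [IsManifold 𝓘(ℝ, C2) ∞ M]
    [LieAlgebra.IsSemisimple ℝ (GroupLieAlgebra 𝓘(ℝ, Vm m) G)] (A : Connection P)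
    (g : Metric M) (e : OpenPartialHomeomorph M C2) (i : ι) : (A.patch g e i).IsLieData where
  br_add x y z := add_lie (L := GroupLieAlgebra 𝓘(ℝ, Vm m) G)
    (M := GroupLieAlgebra 𝓘(ℝ, Vm m) G) x y z
  br_smul r x y := smul_lie (L := GroupLieAlgebra 𝓘(ℝ, Vm m) G)
    (M := GroupLieAlgebra 𝓘(ℝ, Vm m) G) r x y
  br_skew x y := (lie_skew (L := GroupLieAlgebra 𝓘(ℝ, Vm m) G) x y).symm
  jacobi x y z := lie_lie (L := GroupLieAlgebra 𝓘(ℝ, Vm m) G)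
    (M := GroupLieAlgebra 𝓘(ℝ, Vm m) G) x y z
  ip_add x y z := by
    have h := LinearMap.map_add₂ (killingForm ℝ (GroupLieAlgebra 𝓘(ℝ, Vm m) G)) x y z
    exact (congrArg Neg.neg h).trans (neg_add _ _)
  ip_smul r x y := by
    have h := LinearMap.map_smul₂ (killingForm ℝ (GroupLieAlgebra 𝓘(ℝ, Vm m) G)) r x y
    exact (congrArg Neg.neg h).trans (mul_neg _ _).symm
  ip_symm x y := congrArg Neg.neg
    (LieModule.traceForm_comm ℝ (GroupLieAlgebra 𝓘(ℝ, Vm m) G) (GroupLieAlgebra 𝓘(ℝ, Vm m) G) x y)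
  ip_invariant x y z := congrArg Neg.neg (LieModule.traceForm_apply_lie_apply' ℝ
    (GroupLieAlgebra 𝓘(ℝ, Vm m) G) (GroupLieAlgebra 𝓘(ℝ, Vm m) G) x y z)
  ip_nondeg y h := negKilling_nondeg y h

theorem Connection.isKahlerMetric [IsManifold 𝓘(ℝ, C2) ∞ M] (A : Connection P)
    {g : Metric M} (hg : g.IsKahler) {e : OpenPartialHomeomorph M C2} (he : e ∈ atlas C2 M)
    (i : ι) : (A.patch g e i).IsKahlerMetric where
  isOpen := P.isOpen_dom e i
  smooth v w := (g.smooth_loc he v w).mono Set.inter_subset_left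
  add_left z _ u v w := by
    change g.inner _ (dSymm e z (u + v)) _ = _
    rw [dSymm_add, map_add]
    rfl
  smul_left z _ r v w := by
    change g.inner _ (dSymm e z (r • v)) _ = _
    rw [dSymm_smul, map_smul]
    rfl
  symm z _ v w := g.symm _ _ _
  -- Positivity survives in the chart because the differential of the inverse chart is injective.
  pos z hz v hv := g.pos _ _ fun h => hv (dSymm_injective he hz.1
    (h.trans (map_zero (mfderiv 𝓘(ℝ, C2) 𝓘(ℝ, C2) e.symm z)).symm))
  invariant z hz := hg.invariant e he z hz.1
  closed z hz := hg.closed e he z hz.1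

theorem Connection.isRegular [IsManifold 𝓘(ℝ, C2) ∞ M]
    [LieAlgebra.IsSemisimple ℝ (GroupLieAlgebra 𝓘(ℝ, Vm m) G)] (A : Connection P)
    {g : Metric M} (hg : g.IsKahler) {e : OpenPartialHomeomorph M C2} (he : e ∈ atlas C2 M)
    (i : ι) : (A.patch g e i).IsRegular where
  toIsKahlerMetric := A.isKahlerMetric hg he i
  toIsLieData := A.isLieData g e i
  smooth_A := A.smooth e he i

/-- Antilinear maps annihilate vectors of type `(1,0)`. -/
theorem cpt_inl_eq_zero {W : Type*} [AddCommGroup W] [Module ℂ W] {L : C2 → W}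
    (h : ∀ v, L (Complex.I • v) = -(Complex.I • L v)) (μ : Fin 2) : cpt L (Sum.inl μ) = 0 := by
  simp only [cpt, h, smul_neg, smul_smul, Complex.I_mul_I]
  module

omit [LieGroup 𝓘(ℝ, Vm m) ∞ G] in
theorem Form02.isForm_loc (φ : Form02 P) {e : OpenPartialHomeomorph M C2} (he : e ∈ atlas C2 M)
    (i : ι) : Patch.IsForm (P.dom e i) (φ.loc e i) := by
  have hsw : ∀ z v w, φ.form i (e.symm z) ![dSymm e z w, dSymm e z v]
      = -φ.form i (e.symm z) ![dSymm e z v, dSymm e z w] := by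
    intro z v w
    rw [← AlternatingMap.map_swap _ _ (zero_ne_one : (0 : Fin 2) ≠ 1)]
    congr 1
    funext j
    fin_cases j <;> rfl
  have hswap : ∀ z (a : Fin 2 → Idx), φ.loc e i z (a ∘ Equiv.swap 0 1) = -φ.loc e i z a := by
    intro z a
    simp only [Form02.loc, Function.comp_apply, Equiv.swap_apply_left, Equiv.swap_apply_right,
      cpt₂, cpt_eq]
    rw [hsw z (base (a 0)) (base (a 1)), hsw z (base (a 0)) (Complex.I • base (a 1)),
      hsw z (Complex.I • base (a 0)) (base (a 1)),
      hsw z (Complex.I • base (a 0)) (Complex.I • base (a 1))]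
    module
  have hfst : ∀ z ∈ P.dom e i, ∀ a : Fin 2 → Idx, ¬ (a 0).isRight → φ.loc e i z a = 0 := by
    intro z hz a ha
    obtain ⟨μ, hμ⟩ : ∃ μ, a 0 = Sum.inl μ := by
      rcases h : a 0 with μ | ν
      · exact ⟨μ, rfl⟩
      · simp [h] at ha
    rw [Form02.loc, cpt₂, hμ]
    refine cpt_inl_eq_zero (fun v => ?_) μ
    rcases a 1 with ν | ν <;> simp only [cpt, φ.antilinear e he i z hz] <;> module
  refine ⟨fun a => ?_, fun z _ σ a => ?_, fun z hz a ha => ?_⟩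
  · exact contDiffOn_cpt (fun v => contDiffOn_cpt (fun w => φ.smooth e he i v w) (a 1)) (a 0)
  · have hσ : σ = 1 ∨ σ = Equiv.swap 0 1 := by
      revert σ
      decide
    rcases hσ with rfl | rfl
    · simp
    · rw [hswap]
      simp [Units.smul_def]
  · by_cases h0 : (a 0).isRight
    · have h1 : ¬ (a 1).isRight := fun h1 => ha fun j => by
        fin_cases j
        · exact h0
        · exact h1
      -- Antilinearity is given in the first argument only; alternation carries it to the second.
      have := hfst z hz (a ∘ Equiv.swap 0 1) (by simpa using h1)
      rw [hswap] at this
      exact neg_eq_zero.1 this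
    · exact hfst z hz a h0

end Bundle

end KahlerYM

end

theorem mainTheorem9
    {m : ℕ} {G : Type*} [TopologicalSpace G] [ChartedSpace (KahlerYM.Vm m) G] [Group G]
    [LieGroup 𝓘(ℝ, KahlerYM.Vm m) ∞ G] [CompactSpace G]
    [LieAlgebra.IsSemisimple ℝ (GroupLieAlgebra 𝓘(ℝ, KahlerYM.Vm m) G)]
    {M : Type*} [TopologicalSpace M] [T2Space M] [ChartedSpace KahlerYM.C2 M]
    [IsManifold 𝓘(ℂ, KahlerYM.C2) ω M]
    (g : KahlerYM.Metric M) (hg : g.IsKahler)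
    {ι : Type*} (P : KahlerYM.PrincipalBundle m G M ι) (A : KahlerYM.Connection P)
    (φ : KahlerYM.Form02 P)
    (e : OpenPartialHomeomorph M KahlerYM.C2) (he : e ∈ atlas KahlerYM.C2 M) (i : ι) :
    let Q := A.patch g e i
    let f := φ.loc e i
    -- the formal adjoints that occur below exist
    ((∃ χ, Q.IsDbarStar f χ) ∧ (∃ χ, Q.IsDbarStar (Q.dbar f) χ)
      ∧ (∃ χ, Q.IsNablaBarStar (Q.nablaBar f) χ) ∧ (∃ χ, Q.IsNablaStar (Q.nabla f) χ))
    -- the formula, with the rough Laplacian of the `(0,1)`-part of the covariant derivative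
    ∧ (∀ z ∈ Q.D, ∀ a, Q.laplacianDbar f z a
        = Q.nablaBarStar (Q.nablaBar f) z a
          + Complex.I • Q.brC (Q.fHat z) (f z a) + (2 * Q.S z) • f z a)
    -- the formula, with the rough Laplacian of the full covariant derivative
    ∧ (∀ z ∈ Q.D, ∀ a, (2 : ℂ) • Q.laplacianDbar f z a
        = Q.nablaStar (Q.nabla f) z a
          + Complex.I • Q.brC (Q.fHat z) (f z a) + (2 * Q.S z) • f z a) := by
  intro Q f
  exact (A.isRegular hg he i).weitzenboeck (φ.isForm_loc he i)
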